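/- Theorem. Let $T\in(0,\infty)$, $H\in(1/2,1)$, $\beta\in(1/2,H)$, $p\in(1,\frac1{2-2H})$, $\mathcal L>0$, and put $\phi(s,u)=H(2H-1)|s-u|^{2H-2}$. Let $\Omega=C([0,T];\mathbb R)$ with the supremum norm and the Borel $\sigma$-algebra, with coordinate process $B(t)(\omega)=\omega(t)$. Let $\mathcal H=\mathcal H_p\subset\Omega$ be the Banach space of absolutely continuous $h:[0,T]\to\mathbb R$ with $h(0)=0$ and $\|h\|_{\mathcal H}=(\int_0^T|\dot h(s)|^p\,ds)^{1/p}<\infty$. For a normed space $E$, a map $F:\Omega\to E$ is $\mathcal H$-differentiable if for every $\omega$ there is a bounded linear map $\mathbb DF(\omega):\mathcal H\to E$ with $\varepsilon^{-1}(F(\omega+\varepsilon h)-F(\omega))\to\mathbb DF(\omega)h$ as $\varepsilon\to0$ for all $h\in\mathcal H$; $\|\mathbb DF(\omega)\|$ is the operator norm, $\mathbb D^2F=\mathbb D(\mathbb DF)$, and for $E=\mathbb R$ put $\mathbb D^\phi_sF(\omega)=\mathbb DF(\omega)\big(\int_0^\cdot\phi(s,u)\,du\big)$. For $f:[0,T]\to\mathbb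 R$ let $\|f\|_{a,b,\beta}=\sup_{a\le s<t\le b}|f(t)-f(s)|/|t-s|^\beta$. Let $b,\sigma:[0,T]\times\mathbb R\times\Omega\to\mathbb R$ be measurable, $b$ continuously differentiable and $\sigma$ twice continuously differentiable in $x$, $\sigma$ differentiable in $t$, $b$ and $\sigma_x$ $\mathcal H$-differentiable in $\omega$, and $\sigma$ twice $\mathcal H$-differentiable in $\omega$, such that for all $t\in[0,T]$, $x,y\in\mathbb R$, $\omega\in\Omega$, $h\in\mathcal H$: (i) $|b(t,x,\omega)|\le\mathcal L(1+|x|)$, $|b_x(t,x,\omega)|\le\mathcal L$, $\|\mathbb Db(t,x,\omega)\|\le\mathcal L$; (ii) $|\sigma(t,x,\omega)|\le\mathcal L(1+|x|)$; $|\partial_t\sigma(t,0,\omega)|\le\mathcal L$; $|\partial_t\sigma(t,x,\omega+h)-\partial_t\sigma(t,y,\omega)|\le\mathcal L(|x-y|+\|h\|_{\mathcal H})$; $|\sigma_x(t,x,\omega)|+|\sigma_{xx}(t,x,\omega)|\le\mathcal L$; $|\mathbb D^\phi_t\sigma(t,x,\omega)|\le\mathcal L(1+|x|)$; $\|\mathbb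 D\sigma(t,x,\omega)\|+\|\mathbb D^2\sigma(t,x,\omega)\|\le\mathcal L$; $\|\mathbb D\sigma_x(t,x,\omega)\|\le\mathcal L$. Let $\eta:\Omega\to\mathbb R$ and put $\tilde b(s,x,\omega)=b(s,x,\omega)-\mathbb D^\phi_s[\sigma](s,x,\omega)$, $\tilde\sigma=\sigma_x$. For every $\omega\in\Omega$ with $\|B\|_{0,T,\beta}=\|\omega\|_{0,T,\beta}<\infty$ the system $$\Gamma(t)=\omega+\int_0^t\tilde\sigma(s,z(s),\Gamma(s))\int_0^\cdot\phi(s,u)\,du\,ds,$$ $$z(t)=\eta(\omega)+\int_0^t\tilde b(s,z(s),\Gamma(s))\,ds+\int_0^t\sigma(s,z(s),\Gamma(s))\,\delta B(s)+\int_0^t\int_0^s\sigma(s,z(s),\Gamma(s))\,\tilde\sigma(u,z(u),\Gamma(u))\,\phi(s,u)\,du\,ds,$$ $t\in[0,T]$, where $\int\cdot\,\delta B$ is the pathwise integral (the limit of left-point Riemann sums as the mesh tends to $0$), has a unique solution $(\Gamma,z)$ on $[0,T]$ such that $\Gamma-\omega$ is a continuous function $[0,T]\to\mathcal H$ and $z$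 is Hölder continuous of some order greater than $1-\beta$. Moreover there are constants $\tau_0,c_1,c_2>0$, depending only on $H,\beta,p,T,\mathcal L$, such that for all such $b,\sigma,\eta,\omega$ the solution satisfies $$\sup_{0\le t\le T}|z(t)|\le c_2(1+|\eta(\omega)|)\exp\{c_1\|B\|_{0,T,\beta}^{1/\beta}\},$$ $$\sup_{0\le a<b\le T,\ b-a\le\tau_0}\|z\|_{a,b,\beta}\le c_2(1+|\eta(\omega)|)\exp\{c_1\|B\|_{0,T,\beta}^{1/\beta}\}.$$ -/

import Mathlib

open MeasureTheory Set Filter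
open scoped ENNReal Topology

noncomputable section

/-- The sample space `Ω`: the Banach space of continuous functions `[0, T] → ℝ` with the supremum
norm. The driving process is the coordinate process `B(t)(ω) = ω(t)`. -/
abbrev PathSpace (T : ℝ) : Type := C(Icc (0 : ℝ) T, ℝ)

instance (T : ℝ) : MeasurableSpace (PathSpace T) := borel _

instance (T : ℝ) : BorelSpace (PathSpace T) := ⟨rfl⟩

instance (p : ℝ) [hp : Fact (1 < p)] : Fact (1 ≤ ENNReal.ofReal p) :=
  ⟨by simpa using ENNReal.ofReal_le_ofReal hp.out.le⟩

/-- The coordinate process `t ↦ B(t)(ω) = ω(t)`, `t ∈ [0, T]`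
(set to `0` outside `[0, T]`, where it is never used). -/
def coord {T : ℝ} (ω : PathSpace T) (t : ℝ) : ℝ :=
  open Classical in if h : t ∈ Icc (0 : ℝ) T then ω ⟨t, h⟩ else 0

/-- The Hölder seminorm `‖f‖_{a,b,β} = sup_{a ≤ s < t ≤ b} |f(t) - f(s)| / |t - s|^β ∈ [0, ∞]`. -/
def holderSeminorm (β : ℝ) (f : ℝ → ℝ) (a b : ℝ) : ℝ≥0∞ :=
  ⨆ (s : ℝ) (t : ℝ) (_ : a ≤ s ∧ s < t ∧ t ≤ b), ENNReal.ofReal (|f t - f s| / |t - s| ^ β)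

/-- The Banach space `ℋ_p` of absolutely continuous `h : [0, T] → ℝ` with `h(0) = 0` and
`‖h‖ = (∫₀ᵀ |h'(s)|^p ds)^{1/p} < ∞`. An element `h` is represented by its derivative `h'`,
an element of `L^p([0, T])`; this representation is an isometry, see `primitive` and
`mem_range_primitive_iff`. -/
abbrev HpSpace (T p : ℝ) : Type := Lp ℝ (ENNReal.ofReal p) (volume.restrict (Icc (0 : ℝ) T))

theorem HpSpace.integrableOn {T p : ℝ} [Fact (1 < p)] (g : HpSpace T p) :
    IntegrableOn g (Icc (0 : ℝ) T) :=
  (Lp.memLp g).integrable Fact.out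

/-- The path `h = ∫₀^· g(u) du ∈ Ω` of the element of `ℋ_p` with derivative `g`:
the inclusion `ℋ_p ⊆ Ω`. -/
def primitive {T p : ℝ} [Fact (1 < p)] (g : HpSpace T p) : PathSpace T where
  toFun r := ∫ u in (0 : ℝ)..r, g u
  continuous_toFun := by
    rcases le_or_gt 0 T with hT | hT
    · have h := intervalIntegral.continuousOn_primitive_interval (μ := volume) (f := g)
        (a := 0) (b := T) (by simpa [uIcc_of_le hT] using g.integrableOn)
      rw [uIcc_of_le hT] at h
      exact h.domRestrict
    · have : IsEmpty (Icc (0 : ℝ) T) := by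
        rw [isEmpty_coe_sort]; exact Icc_eq_empty (not_le.2 hT)
      exact continuous_of_const fun x => (this.false x).elim

/-- The range of `primitive` consists exactly of the absolutely continuous paths which vanish at
`0` and have a `p`-integrable derivative. -/
theorem mem_range_primitive_iff {T p : ℝ} [Fact (1 < p)] (hT : 0 ≤ T) (h : PathSpace T) :
    h ∈ range (primitive (T := T) (p := p)) ↔
      AbsolutelyContinuousOnInterval (coord h) 0 T ∧ coord h 0 = 0 ∧
        MemLp (deriv (coord h)) (ENNReal.ofReal p) (volume.restrict (Icc (0 : ℝ) T)) := by
  constructor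
  · rintro ⟨g, rfl⟩
    have hg : IntervalIntegrable g volume 0 T := by
      rw [intervalIntegrable_iff_integrableOn_Icc_of_le hT]; exact g.integrableOn
    have heq : EqOn (coord (primitive g)) (fun r => ∫ u in (0 : ℝ)..r, g u) (Icc 0 T) := by
      intro r hr
      simp only [coord, dif_pos hr]
      rfl
    refine ⟨?_, ?_, ?_⟩
    · have hac := hg.absolutelyContinuousOnInterval_intervalIntegral (c := 0) (by simp)
      rw [absolutelyContinuousOnInterval_iff] at hac ⊢
      intro ε hε
      obtain ⟨δ, hδ, H⟩ := hac ε hε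
      refine ⟨δ, hδ, fun E hE hlt => ?_⟩
      refine lt_of_eq_of_lt (Finset.sum_congr rfl fun i hi => ?_) (H E hE hlt)
      have hmem := hE.1 i hi
      rw [uIcc_of_le hT] at hmem
      rw [heq hmem.1, heq hmem.2]
    · rw [heq ⟨le_rfl, hT⟩]; simp
    · refine (memLp_congr_ae ?_).2 (Lp.memLp g)
      rw [EventuallyEq, ae_restrict_iff' measurableSet_Icc]
      filter_upwards [hg.ae_hasDerivAt_integral, volume.ae_ne 0, volume.ae_ne T]
        with x hx hx0 hx1 hxI
      have hxT : x ∈ Ioo 0 T := ⟨lt_of_le_of_ne hxI.1 hx0.symm, lt_of_le_of_ne hxI.2 hx1⟩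
      have hx' := hx (by rw [uIcc_of_le hT]; exact Ioo_subset_Icc_self hxT) 0 (by simp)
      refine (hx'.congr_of_eventuallyEq ?_).deriv
      filter_upwards [Icc_mem_nhds hxT.1 hxT.2] with y hy using heq hy
  · rintro ⟨hac, h0, hLp⟩
    refine ⟨hLp.toLp (deriv (coord h)), ?_⟩
    ext r
    have hr := r.2
    have hac' : AbsolutelyContinuousOnInterval (coord h) 0 r :=
      hac.mono (by rw [uIcc_of_le hT, uIcc_of_le hr.1]; exact Icc_subset_Icc_right hr.2)
    have e1 := hac'.integral_deriv_eq_sub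
    rw [h0, sub_zero] at e1
    have e2 : coord h r = h r := by simp [coord]
    rw [← e2, ← e1]
    change ∫ u in (0 : ℝ)..r, hLp.toLp (deriv (coord h)) u = _
    refine intervalIntegral.integral_congr_ae ?_
    have hae := hLp.coeFn_toLp
    rw [EventuallyEq, ae_restrict_iff' measurableSet_Icc] at hae
    filter_upwards [hae] with u hu hur
    rw [uIoc_of_le hr.1] at hur
    exact hu ⟨hur.1.le, hur.2.trans hr.2⟩

/-- `F : Ω → E` is `ℋ_p`-differentiable at `ω` with derivative the bounded linear map `D`:
`(F(ω + ε h) - F(ω)) / ε → D h` as `ε → 0`, for every `h ∈ ℋ_p`. -/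
def HasHDerivAt {T p : ℝ} [Fact (1 < p)] {E : Type*} [NormedAddCommGroup E] [NormedSpace ℝ E]
    (F : PathSpace T → E) (D : HpSpace T p →L[ℝ] E) (ω : PathSpace T) : Prop :=
  ∀ h : HpSpace T p, HasDerivAt (fun ε : ℝ => F (ω + ε • primitive h)) (D h) 0

/-- `F` is `ℋ_p`-differentiable (at every `ω ∈ Ω`). -/
def HDifferentiable {T : ℝ} (p : ℝ) [Fact (1 < p)] {E : Type*} [NormedAddCommGroup E]
    [NormedSpace ℝ E] (F : PathSpace T → E) : Prop :=
  ∀ ω, ∃ D : HpSpace T p →L[ℝ] E, HasHDerivAt F D ω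

open Classical in
/-- The derivative `𝔻F(ω)`, a bounded linear map `ℋ_p → E`; its norm is the operator norm. -/
def hDeriv {T : ℝ} (p : ℝ) [Fact (1 < p)] {E : Type*} [NormedAddCommGroup E] [NormedSpace ℝ E]
    (F : PathSpace T → E) (ω : PathSpace T) : HpSpace T p →L[ℝ] E :=
  if h : ∃ D : HpSpace T p →L[ℝ] E, HasHDerivAt F D ω then h.choose else 0

/-- The kernel `φ(s, u) = H (2H - 1) |s - u|^{2H - 2}`. -/
def phi (H s u : ℝ) : ℝ := H * (2 * H - 1) * |s - u| ^ (2 * H - 2)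

/-- For `1 < p < 1 / (2 - 2H)` the function `φ(s, ·)` is in `L^p([0, T])`. -/
theorem memLp_phi {T p H : ℝ} [hp1 : Fact (1 < p)] (hH : H < 1) (hp : p < 1 / (2 - 2 * H))
    (s : ℝ) : MemLp (phi H s) (ENNReal.ofReal p) (volume.restrict (Icc (0 : ℝ) T)) := by
  have hp0 : (0 : ℝ) < p := zero_lt_one.trans hp1.out
  have hpH : p * (2 - 2 * H) < 1 := by rwa [lt_div_iff₀ (by linarith)] at hp
  have hmeas : Measurable (phi H s) := by unfold phi; fun_prop
  refine MemLp.mono_measure (Measure.restrict_mono (Icc_subset_Icc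
    (min_le_left 0 T) (le_max_right 0 T)) le_rfl) ?_
  rw [← integrable_norm_rpow_iff hmeas.aestronglyMeasurable (by simpa using hp0)
    ENNReal.ofReal_ne_top, ENNReal.toReal_ofReal hp0.le]
  have key : IntervalIntegrable (fun u : ℝ => |u| ^ (p * (2 * H - 2))) volume
      (min 0 T - s) (max 0 T - s) := by
    have h1 : -1 < p * (2 * H - 2) := by linarith
    have h0 : ∀ c : ℝ, 0 ≤ c →
        IntervalIntegrable (fun u : ℝ => |u| ^ (p * (2 * H - 2))) volume 0 c := by
      intro c hc
      refine (intervalIntegral.intervalIntegrable_rpow' (a := 0) (b := c) h1).congr ?_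
      intro u hu
      rw [uIoc_of_le hc] at hu
      simp [abs_of_pos hu.1]
    have h2 : ∀ c : ℝ,
        IntervalIntegrable (fun u : ℝ => |u| ^ (p * (2 * H - 2))) volume 0 c := by
      intro c
      rcases le_total 0 c with hc | hc
      · exact h0 c hc
      · have := (IntervalIntegrable.iff_comp_neg (a := 0) (b := -c)).1 (h0 (-c) (by linarith))
        simpa using this
    exact (h2 _).symm.trans (h2 _)
  have key2 := (key.comp_sub_right s).const_mul (|H * (2 * H - 1)| ^ p)
  rw [sub_add_cancel, sub_add_cancel, intervalIntegrable_iff_integrableOn_Icc_of_le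
    (min_le_max)] at key2
  refine key2.congr (ae_of_all _ fun u => ?_)
  simp only [phi, norm_mul, Real.norm_eq_abs]
  rw [← abs_mul, Real.mul_rpow (abs_nonneg _) (abs_nonneg _), abs_sub_comm u s,
    abs_of_nonneg (Real.rpow_nonneg (abs_nonneg (s - u)) _), ← Real.rpow_mul (abs_nonneg _),
    mul_comm p]

open Classical in
/-- The element `∫₀^· φ(s, u) du` of `ℋ_p`, whose derivative is `φ(s, ·)`
(it is in `ℋ_p` by `memLp_phi`). -/
def phiH (T p H s : ℝ) : HpSpace T p :=
  if h : MemLp (phi H s) (ENNReal.ofReal p) (volume.restrict (Icc (0 : ℝ) T)) then h.toLp else 0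

/-- The Malliavin derivative `𝔻^φ_s F(ω)`, that is `∫₀ᵀ φ(s, u) 𝔻_u F(ω) du` where `𝔻_u F(ω)` is
the density of `𝔻F(ω)`, `𝔻F(ω)(h) = ∫₀ᵀ 𝔻_u F(ω) h'(u) du`. In other words it is the
derivative of `F` in the direction `∫₀^· φ(s, u) du`. -/
def dPhi {T : ℝ} (p H : ℝ) [Fact (1 < p)] (s : ℝ) (F : PathSpace T → ℝ) (ω : PathSpace T) : ℝ :=
  hDeriv p F ω (phiH T p H s)

/-- `I = ∫₀ᵗ f(s) δg(s)` as a pathwise integral: the left-point Riemann sums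
`∑ f(s_i) (g(s_{i+1}) - g(s_i))` over partitions `0 = s_0 < ⋯ < s_n = t` converge to `I` as the
mesh tends to `0`. -/
def IsPathwiseIntegral (f g : ℝ → ℝ) (t I : ℝ) : Prop :=
  ∀ ε > 0, ∃ δ > 0, ∀ (n : ℕ) (s : ℕ → ℝ), s 0 = 0 → s n = t →
    (∀ i < n, s i < s (i + 1) ∧ s (i + 1) - s i < δ) →
    |∑ i ∈ Finset.range n, f (s i) * (g (s (i + 1)) - g (s i)) - I| < ε

/-- The partial derivative `σ_x(t, x, ω)`. -/
def partialX {T : ℝ} (σ : ℝ → ℝ → PathSpace T → ℝ) (t x : ℝ) (ω : PathSpace T) : ℝ :=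
  deriv (fun y => σ t y ω) x

/-- The partial derivative `∂σ/∂t (t, x, ω)`, for `t ∈ [0, T]` (one-sided at the end points). -/
def partialT {T : ℝ} (σ : ℝ → ℝ → PathSpace T → ℝ) (t x : ℝ) (ω : PathSpace T) : ℝ :=
  derivWithin (fun r => σ r x ω) (Icc 0 T) t

/-- The corrected drift `b̃(s, x, ω) = b(s, x, ω) - 𝔻^φ_s[σ](s, x, ω)`. -/
def bTilde {T : ℝ} (p H : ℝ) [Fact (1 < p)] (b σ : ℝ → ℝ → PathSpace T → ℝ) (s x : ℝ)
    (ω : PathSpace T) : ℝ :=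
  b s x ω - dPhi p H s (σ s x) ω

/-- The hypotheses on the coefficients `b, σ : [0, T] × ℝ × Ω → ℝ`, with bound `L`
(only the values at times in `[0, T]` matter). -/
structure CoefficientHypothesis (T p H L : ℝ) [Fact (1 < p)]
    (b σ : ℝ → ℝ → PathSpace T → ℝ) : Prop where
  b_measurable : Measurable fun q : Icc (0 : ℝ) T × ℝ × PathSpace T => b q.1 q.2.1 q.2.2
  b_contDiff : ∀ t ∈ Icc 0 T, ∀ ω, ContDiff ℝ 1 fun x => b t x ω
  b_growth : ∀ t ∈ Icc 0 T, ∀ x ω, |b t x ω| ≤ L * (1 + |x|)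
  b_partialX : ∀ t ∈ Icc 0 T, ∀ x ω, |partialX b t x ω| ≤ L
  b_hDifferentiable : ∀ t ∈ Icc 0 T, ∀ x, HDifferentiable p (b t x)
  b_hDeriv : ∀ t ∈ Icc 0 T, ∀ x ω, ‖hDeriv p (b t x) ω‖ ≤ L
  σ_measurable : Measurable fun q : Icc (0 : ℝ) T × ℝ × PathSpace T => σ q.1 q.2.1 q.2.2
  σ_contDiff : ∀ t ∈ Icc 0 T, ∀ ω, ContDiff ℝ 2 fun x => σ t x ω
  σ_growth : ∀ t ∈ Icc 0 T, ∀ x ω, |σ t x ω| ≤ L * (1 + |x|)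
  σ_differentiable : ∀ x ω, DifferentiableOn ℝ (fun t => σ t x ω) (Icc 0 T)
  σ_partialT_zero : ∀ t ∈ Icc 0 T, ∀ ω, |partialT σ t 0 ω| ≤ L
  σ_partialT : ∀ t ∈ Icc 0 T, ∀ x y ω, ∀ h : HpSpace T p,
    |partialT σ t x (ω + primitive h) - partialT σ t y ω| ≤ L * (|x - y| + ‖h‖)
  σ_partialX : ∀ t ∈ Icc 0 T, ∀ x ω, |partialX σ t x ω| + |partialX (partialX σ) t x ω| ≤ L
  σ_dPhi : ∀ t ∈ Icc 0 T, ∀ x ω, |dPhi p H t (σ t x) ω| ≤ L * (1 + |x|)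
  σ_hDifferentiable : ∀ t ∈ Icc 0 T, ∀ x, HDifferentiable p (σ t x)
  σ_hDifferentiable₂ : ∀ t ∈ Icc 0 T, ∀ x, HDifferentiable p (hDeriv p (σ t x))
  σ_hDeriv : ∀ t ∈ Icc 0 T, ∀ x ω,
    ‖hDeriv p (σ t x) ω‖ + ‖hDeriv p (hDeriv p (σ t x)) ω‖ ≤ L
  σ_partialX_hDifferentiable : ∀ t ∈ Icc 0 T, ∀ x, HDifferentiable p (partialX σ t x)
  σ_partialX_hDeriv : ∀ t ∈ Icc 0 T, ∀ x ω, ‖hDeriv p (partialX σ t x) ω‖ ≤ L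

/-- `(Γ, z)` solves the characteristic system on `[0, T]` along the path `ω`. -/
structure IsCharacteristicSolution {T : ℝ} (p H β : ℝ) [Fact (1 < p)]
    (b σ : ℝ → ℝ → PathSpace T → ℝ) (η : PathSpace T → ℝ) (ω : PathSpace T)
    (Γ : ℝ → PathSpace T) (z : ℝ → ℝ) : Prop where
  /-- `Γ - ω` is a continuous function `[0, T] → ℋ_p`. -/
  shift : ∃ G : ℝ → HpSpace T p, ContinuousOn G (Icc 0 T) ∧
    ∀ t ∈ Icc 0 T, Γ t = ω + primitive (G t)
  /-- `z` is Hölder continuous of some order `μ > 1 - β`. -/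
  holder : ∃ μ > 1 - β, holderSeminorm μ z 0 T < ∞
  integrable_Γ : IntervalIntegrable
    (fun s => partialX σ s (z s) (Γ s) • phiH T p H s) volume 0 T
  eq_Γ : ∀ t ∈ Icc 0 T,
    Γ t = ω + primitive (∫ s in (0 : ℝ)..t, partialX σ s (z s) (Γ s) • phiH T p H s)
  integrable_b : IntervalIntegrable (fun s => bTilde p H b σ s (z s) (Γ s)) volume 0 T
  integrable_inner : ∀ s ∈ Icc 0 T, IntervalIntegrable
    (fun u => σ s (z s) (Γ s) * partialX σ u (z u) (Γ u) * phi H s u) volume 0 s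
  integrable_outer : IntervalIntegrable
    (fun s => ∫ u in (0 : ℝ)..s, σ s (z s) (Γ s) * partialX σ u (z u) (Γ u) * phi H s u)
    volume 0 T
  eq_z : ∀ t ∈ Icc 0 T, ∃ I : ℝ,
    IsPathwiseIntegral (fun s => σ s (z s) (Γ s)) (coord ω) t I ∧
    z t = η ω + (∫ s in (0 : ℝ)..t, bTilde p H b σ s (z s) (Γ s)) + I +
      ∫ s in (0 : ℝ)..t, ∫ u in (0 : ℝ)..s,
        σ s (z s) (Γ s) * partialX σ u (z u) (Γ u) * phi H s u

end

/-!
The system is solved in the state space `ℝ × ℋ_p` of `y = (z, G)`, where `Γ = ω + G`. There it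
reads `y(t) = y₀ + ∫₀ᵗ U[y](s) ds + (∫₀ᵗ f(s, y(s)) dB(s)) (1, 0)`, with
`f(s, (x, G)) = σ(s, x, ω + G)` and a drift `U[y](s)` which depends on the past of `y`. The
`ℋ`-derivatives occur only through increments: by the mean value inequality `f` is Lipschitz, its
second-order increments satisfy `|f(y + h + k) - f(y + h) - f(y + k) + f(y)| ≤ K ‖h‖ ‖k‖`, and `U`
is Lipschitz in the supremum norm of the past (`CoefficientHypothesis.youngVolterra`).

The pathwise integral is a Young integral. The maximal inequality of the sewing lemma
(`abs_sum_sub_le_of_almost_additive`) gives a primitive `J` whose increments agree with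
`f(s) (g(t) - g(s))` up to order `(t - s) ^ θ`, `θ > 1` (`exists_isYoungPrimitive`). This
characterizes `J`, gives the convergence of all Riemann sums, and survives differences.

The equation is then treated on all of `[0, T]` at once, with a weighted Hölder bound at a time
scale `h` (`WeightedBound`): `‖y(t)‖ ≤ ρ e^{t/h}`, and
`‖y(t) - y(s)‖ ≤ ρ e^{t/h} ((t - s)/h)^α` if `t - s ≤ h`. In such a bound the two integrals gain a
factor of order `h + Λ h^β`, where `Λ` is the Hölder seminorm of the driving path
(`WeightedBound.of_integral`); the weight lets increments over steps of length `h` control the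
supremum (`WeightedBound.of_sub_le`).

As the coefficients grow linearly, the Picard map preserves the ball of radius `1 + 4 |η|` as soon
as `h` is a small multiple of `1 / (1 + Λ^{1/β})` (`YoungVolterra.picard_mem_ball`), and then
`e^{T/h}` is the exponential factor in the asserted bounds. On bounded sets the Picard map contracts
the weighted norm at a second, much smaller scale (`YoungVolterra.picard_contract`), which gives
existence by iteration, and uniqueness in every Hölder class of order greater than `1 - β`.
-/

/-! ### The Young integral by sewing -/

/-- The constant of the sewing estimate; it solves `C = 2 + 2 ^ (1 - θ) * C`. -/
noncomputable def sewConst (θ : ℝ) : ℝ := 2 / (1 - 2 ^ (1 - θ))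

theorem two_rpow_lt_one {θ : ℝ} (hθ : 1 < θ) : (2 : ℝ) ^ (1 - θ) < 1 :=
  Real.rpow_lt_one_of_one_lt_of_neg (by norm_num) (by linarith)

theorem sewConst_pos {θ : ℝ} (hθ : 1 < θ) : 0 < sewConst θ :=
  div_pos two_pos (by linarith [two_rpow_lt_one hθ])

theorem sewConst_eq {θ : ℝ} (hθ : 1 < θ) : 2 + 2 * (sewConst θ * 2⁻¹ ^ θ) = sewConst θ := by
  have h1 : (1 : ℝ) - 2 ^ (1 - θ) ≠ 0 := by linarith [two_rpow_lt_one hθ]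
  have h2 : (2 : ℝ) * 2⁻¹ ^ θ = 2 ^ (1 - θ) := by
    rw [Real.inv_rpow (by norm_num), ← Real.rpow_neg (by norm_num), sub_eq_add_neg,
      Real.rpow_add (by norm_num), Real.rpow_one]
  have h3 : 2 * (sewConst θ * 2⁻¹ ^ θ) = sewConst θ * (2 ^ (1 - θ)) := by rw [← h2]; ring
  rw [h3, sewConst]
  field_simp
  ring

/-- The maximal inequality of the sewing lemma: a germ `A` which is additive up to
`K * (t - s) ^ θ`, `θ > 1`, has partition sums which are comparable with `A` on the whole interval.
The partition is bisected at the cell that contains the midpoint. -/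
theorem abs_sum_sub_le_of_almost_additive {A : ℝ → ℝ → ℝ} {a b K θ : ℝ} (hθ : 1 < θ) (hK : 0 ≤ K)
    (hA : ∀ s u t, a ≤ s → s ≤ u → u ≤ t → t ≤ b → |A s t - A s u - A u t| ≤ K * (t - s) ^ θ)
    {r : ℕ → ℝ} (hr : Monotone r) (n : ℕ) :
    ∀ m k, m ≤ k → k - m ≤ n → a ≤ r m → r k ≤ b →
      |∑ i ∈ Finset.Ico m k, A (r i) (r (i + 1)) - A (r m) (r k)| ≤
        sewConst θ * K * (r k - r m) ^ θ := by
  have hC := sewConst_pos hθ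
  have hself : ∀ x, a ≤ x → x ≤ b → A x x = 0 := by
    intro x h1 h2
    have h := hA x x x h1 le_rfl le_rfl h2
    rw [sub_self (A x x), sub_self x, Real.zero_rpow (by linarith), mul_zero, zero_sub,
      abs_neg] at h
    exact abs_nonpos_iff.1 h
  induction n using Nat.strong_induction_on with
  | _ n ih =>
  intro m k hmk hkn ham hkb
  rcases hmk.eq_or_lt with rfl | hlt
  · rw [Finset.Ico_self, Finset.sum_empty, hself _ ham hkb]
    simp [Real.zero_rpow (by linarith : θ ≠ 0)]
  have hrmk := hr hmk
  classical
  -- the cell `[r i, r (i + 1)]` contains the midpoint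
  have hex : ∃ j, m < j ∧ (r m + r k) / 2 ≤ r j := ⟨k, hlt, by linarith⟩
  obtain ⟨j, hj, hjmin⟩ : ∃ j, (m < j ∧ (r m + r k) / 2 ≤ r j) ∧
      ∀ i < j, ¬ (m < i ∧ (r m + r k) / 2 ≤ r i) :=
    ⟨Nat.find hex, Nat.find_spec hex, fun i hi => Nat.find_min hex hi⟩
  obtain ⟨i, rfl⟩ : ∃ i, j = i + 1 := ⟨j - 1, by omega⟩
  have hik : i + 1 ≤ k := by
    by_contra! hcon
    exact hjmin k hcon ⟨hlt, by linarith⟩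
  have hmi : m ≤ i := by omega
  have hri : r i ≤ (r m + r k) / 2 := by
    rcases hmi.eq_or_lt with rfl | hlt'
    · linarith
    · by_contra! hcon
      exact hjmin i (by omega) ⟨hlt', hcon.le⟩
  have h1 := hr hmi
  have h2 : r i ≤ r (i + 1) := hr (Nat.le_succ i)
  have h3 := hr hik
  have e1 := ih (i - m) (by omega) m i hmi le_rfl ham (by linarith)
  have e2 := ih (k - (i + 1)) (by omega) (i + 1) k hik le_rfl (by linarith) hkb
  have e3 := hA (r m) (r i) (r k) ham h1 (h2.trans h3) hkb
  have e4 := hA (r i) (r (i + 1)) (r k) (ham.trans h1) h2 h3 hkb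
  have hsum : ∑ l ∈ Finset.Ico m k, A (r l) (r (l + 1)) =
      ∑ l ∈ Finset.Ico m i, A (r l) (r (l + 1)) + A (r i) (r (i + 1)) +
        ∑ l ∈ Finset.Ico (i + 1) k, A (r l) (r (l + 1)) := by
    rw [← Finset.sum_Ico_consecutive _ hmi (by omega : i ≤ k),
      Finset.sum_eq_sum_Ico_succ_bot (by omega : i < k)]
    ring
  have half : ∀ x, 0 ≤ x → x ≤ (r k - r m) / 2 → x ^ θ ≤ 2⁻¹ ^ θ * (r k - r m) ^ θ := by
    intro x hx hx2
    rw [← Real.mul_rpow (by norm_num) (by linarith)]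
    exact Real.rpow_le_rpow hx (by linarith) (by linarith)
  have f1 : sewConst θ * K * (r i - r m) ^ θ ≤
      sewConst θ * K * (2⁻¹ ^ θ * (r k - r m) ^ θ) :=
    mul_le_mul_of_nonneg_left (half _ (by linarith) (by linarith)) (by positivity)
  have f2 : sewConst θ * K * (r k - r (i + 1)) ^ θ ≤
      sewConst θ * K * (2⁻¹ ^ θ * (r k - r m) ^ θ) :=
    mul_le_mul_of_nonneg_left (half _ (by linarith) (by linarith [hj.2])) (by positivity)
  have f3 : K * (r k - r i) ^ θ ≤ K * (r k - r m) ^ θ :=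
    mul_le_mul_of_nonneg_left (Real.rpow_le_rpow (by linarith)
      (by linarith) (by linarith)) hK
  have key : sewConst θ * K * (r k - r m) ^ θ = 2 * (K * (r k - r m) ^ θ) +
      2 * (sewConst θ * K * (2⁻¹ ^ θ * (r k - r m) ^ θ)) := by
    nth_rewrite 1 [← sewConst_eq hθ]
    ring
  rw [hsum, key]
  rw [abs_le] at *
  constructor <;> linarith [e1.1, e1.2, e2.1, e2.2, e3.1, e3.2, e4.1, e4.2]

/-- `J` is a primitive of `f dg` on `[0, T]` in the sense of Young: its increments agree with the
left-point germ `f(s) (g(t) - g(s))` up to the order `(t - s) ^ θ`. -/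
def IsYoungPrimitive (θ T : ℝ) (f g J : ℝ → ℝ) : Prop :=
  ∃ C, ∀ s t, 0 ≤ s → s ≤ t → t ≤ T → |J t - J s - f s * (g t - g s)| ≤ C * (t - s) ^ θ

theorem IsYoungPrimitive.sub {θ T : ℝ} {f₁ f₂ g J₁ J₂ : ℝ → ℝ}
    (h₁ : IsYoungPrimitive θ T f₁ g J₁) (h₂ : IsYoungPrimitive θ T f₂ g J₂) :
    IsYoungPrimitive θ T (fun s => f₁ s - f₂ s) g (fun s => J₁ s - J₂ s) := by
  obtain ⟨C₁, h₁⟩ := h₁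
  obtain ⟨C₂, h₂⟩ := h₂
  refine ⟨C₁ + C₂, fun s t hs hst ht => ?_⟩
  have e : J₁ t - J₂ t - (J₁ s - J₂ s) - (f₁ s - f₂ s) * (g t - g s) =
    (J₁ t - J₁ s - f₁ s * (g t - g s)) - (J₂ t - J₂ s - f₂ s * (g t - g s)) := by ring
  rw [e, add_mul]
  exact (abs_sub _ _).trans (add_le_add (h₁ s t hs hst ht) (h₂ s t hs hst ht))

/-- Partition sums of the germ of a Young primitive converge at the rate `mesh ^ (θ - 1)`. -/
theorem abs_sum_sub_le_of_young {θ T C δ : ℝ} (hθ : 1 < θ) {f g J : ℝ → ℝ} (hC : 0 ≤ C)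
    (hJ : ∀ s t, 0 ≤ s → s ≤ t → t ≤ T → |J t - J s - f s * (g t - g s)| ≤ C * (t - s) ^ θ)
    (n : ℕ) {r : ℕ → ℝ} (h0 : 0 ≤ r 0) (hn : r n ≤ T)
    (hr : ∀ i < n, r i ≤ r (i + 1) ∧ r (i + 1) - r i ≤ δ) :
    |∑ i ∈ Finset.range n, f (r i) * (g (r (i + 1)) - g (r i)) - (J (r n) - J (r 0))| ≤
      C * δ ^ (θ - 1) * (r n - r 0) := by
  induction n with
  | zero => simp
  | succ n ih =>
    have hmono : ∀ k ≤ n, r 0 ≤ r k := by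
      intro k hk
      induction k with
      | zero => exact le_rfl
      | succ k ihk => exact (ihk (by omega)).trans (hr k (by omega)).1
    obtain ⟨h1, h2⟩ := hr n (by omega)
    have e1 := ih (h1.trans hn) (fun i hi => hr i (by omega))
    have e2 := hJ (r n) (r (n + 1)) (h0.trans (hmono n le_rfl)) h1 hn
    have e3 : (r (n + 1) - r n) ^ θ ≤ δ ^ (θ - 1) * (r (n + 1) - r n) := by
      rcases h1.eq_or_lt with h | h
      · rw [← h, sub_self, Real.zero_rpow (by linarith)]; simp
      · have e : θ = (θ - 1) + 1 := by ring
        nth_rewrite 1 [e]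
        rw [Real.rpow_add (by linarith), Real.rpow_one]
        exact mul_le_mul_of_nonneg_right
          (Real.rpow_le_rpow (by linarith) h2 (by linarith)) (by linarith)
    have e4 := mul_le_mul_of_nonneg_left e3 hC
    rw [Finset.sum_range_succ]
    rw [abs_le] at *
    constructor <;> nlinarith [e1.1, e1.2, e2.1, e2.2]

theorem tendsto_mul_div_rpow {θ : ℝ} (hθ : 1 < θ) (x c : ℝ) :
    Tendsto (fun n : ℕ => c * (x / (n + 1 : ℝ)) ^ (θ - 1)) atTop (𝓝 0) := by
  have h1 : Tendsto (fun n : ℕ => x / (n + 1 : ℝ)) atTop (𝓝 0) :=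
    tendsto_const_nhds.div_atTop (tendsto_atTop_add_const_right _ _ tendsto_natCast_atTop_atTop)
  have h2 := (h1.rpow_const (p := θ - 1) (Or.inr (by linarith))).const_mul c
  rwa [Real.zero_rpow (by linarith), mul_zero] at h2

/-- A Young primitive restricted to `[s, t]` inherits the sewing estimate with the constant of the
germ on `[s, t]`. -/
theorem IsYoungPrimitive.abs_sub_le {θ T K s t : ℝ} (hθ : 1 < θ) (hK : 0 ≤ K) {f g J : ℝ → ℝ}
    (hJ : IsYoungPrimitive θ T f g J) (hs : 0 ≤ s) (hst : s ≤ t) (ht : t ≤ T)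
    (hA : ∀ x u y, s ≤ x → x ≤ u → u ≤ y → y ≤ t →
      |(f x - f u) * (g y - g u)| ≤ K * (y - x) ^ θ) :
    |J t - J s - f s * (g t - g s)| ≤ sewConst θ * K * (t - s) ^ θ := by
  obtain ⟨C₀, hC₀⟩ := hJ
  set C := max C₀ 0
  have hC : ∀ s t, 0 ≤ s → s ≤ t → t ≤ T →
      |J t - J s - f s * (g t - g s)| ≤ C * (t - s) ^ θ := fun s t h1 h2 h3 =>
    (hC₀ s t h1 h2 h3).trans (mul_le_mul_of_nonneg_right (le_max_left _ _)
      (Real.rpow_nonneg (by linarith) _))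
  have hlim := tendsto_mul_div_rpow hθ (t - s) C
  have hlim' := (hlim.mul_const (t - s)).add_const (sewConst θ * K * (t - s) ^ θ)
  rw [zero_mul, zero_add] at hlim'
  refine ge_of_tendsto' hlim' fun n => ?_
  have hn : (0 : ℝ) < n + 1 := by positivity
  set d := (t - s) / (n + 1 : ℝ)
  have hd : 0 ≤ d := div_nonneg (sub_nonneg.2 hst) hn.le
  have hdn : (n + 1 : ℝ) * d = t - s := by simp only [d]; field_simp
  set r : ℕ → ℝ := fun i => s + i * d
  have hr : Monotone r := fun i j hij => by
    have : (i : ℝ) ≤ j := by exact_mod_cast hij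
    simp only [r]; nlinarith
  have r0 : r 0 = s := by simp [r]
  have rn : r (n + 1) = t := by simp only [r]; push_cast; linarith
  have e1 := abs_sum_sub_le_of_almost_additive (A := fun x y => f x * (g y - g x)) hθ hK
    (a := s) (b := t) (fun x u y h1 h2 h3 h4 => by
      have := hA x u y h1 h2 h3 h4
      have e : f x * (g y - g x) - f x * (g u - g x) - f u * (g y - g u) =
        (f x - f u) * (g y - g u) := by ring
      rwa [e]) hr (n + 1) 0 (n + 1) (by omega) (by omega) r0.ge rn.le
  have e2 := abs_sum_sub_le_of_young (δ := d) hθ (le_max_right C₀ 0) hC (n + 1) (r := r)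
    (by rw [r0]; exact hs) (by rw [rn]; exact ht) (fun i _ => ⟨hr (Nat.le_succ i), by
      simp only [r]; push_cast; linarith⟩)
  rw [← Finset.range_eq_Ico] at e1
  simp only [r0, rn] at e1 e2

  rw [abs_le] at *
  constructor <;> linarith [e1.1, e1.2, e2.1, e2.2]

/-- The germ estimate for Hölder functions `f` and `g`. -/
theorem abs_germ_le {α β q Λ s t : ℝ} (hα : 0 ≤ α) (hβ : 0 ≤ β) {f g : ℝ → ℝ} (hq : 0 ≤ q)
    (hΛ : 0 ≤ Λ) (hf : ∀ x u, s ≤ x → x ≤ u → u ≤ t → |f u - f x| ≤ q * (u - x) ^ α)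
    (hg : ∀ x u, s ≤ x → x ≤ u → u ≤ t → |g u - g x| ≤ Λ * (u - x) ^ β) (x u y : ℝ)
    (hx : s ≤ x) (hxu : x ≤ u) (huy : u ≤ y) (hy : y ≤ t) :
    |(f x - f u) * (g y - g u)| ≤ q * Λ * (y - x) ^ (α + β) := by
  rw [abs_mul, abs_sub_comm]
  have h1 : |f u - f x| ≤ q * (y - x) ^ α :=
    (hf x u hx hxu (huy.trans hy)).trans (mul_le_mul_of_nonneg_left
      (Real.rpow_le_rpow (by linarith) (by linarith) hα) hq)
  have h2 : |g y - g u| ≤ Λ * (y - x) ^ β :=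
    (hg u y (hx.trans hxu) huy hy).trans (mul_le_mul_of_nonneg_left
      (Real.rpow_le_rpow (by linarith) (by linarith) hβ) hΛ)
  have hyx : 0 ≤ y - x := by linarith
  rw [Real.rpow_add_of_nonneg hyx hα hβ]
  calc _ ≤ (q * (y - x) ^ α) * (Λ * (y - x) ^ β) :=
        mul_le_mul h1 h2 (abs_nonneg _) (mul_nonneg hq (Real.rpow_nonneg hyx _))
    _ = _ := by ring

/-- Existence of the Young integral. The partition sums over uniform partitions, clipped at `t`,
are bounded by the maximal inequality; a limit along an ultrafilter is a Young primitive. -/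
theorem exists_isYoungPrimitive {θ T K : ℝ} (hθ : 1 < θ) (hK : 0 ≤ K) (hT : 0 ≤ T) {f g : ℝ → ℝ}
    (hA : ∀ x u y, 0 ≤ x → x ≤ u → u ≤ y → y ≤ T →
      |(f x - f u) * (g y - g u)| ≤ K * (y - x) ^ θ) :
    ∃ J : ℝ → ℝ, J 0 = 0 ∧ IsYoungPrimitive θ T f g J := by
  set A : ℝ → ℝ → ℝ := fun x y => f x * (g y - g x)
  have hself : ∀ x, A x x = 0 := fun x => by simp [A]
  have hA' : ∀ x u y, 0 ≤ x → x ≤ u → u ≤ y → y ≤ T →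
      |A x y - A x u - A u y| ≤ K * (y - x) ^ θ := fun x u y h1 h2 h3 h4 => by
    have e : A x y - A x u - A u y = (f x - f u) * (g y - g u) := by simp only [A]; ring
    rw [e]; exact hA x u y h1 h2 h3 h4
  set d : ℕ → ℕ → ℝ := fun n i => i * (T / (n + 1 : ℝ))
  have hTn : ∀ n : ℕ, 0 ≤ T / (n + 1 : ℝ) := fun n => by positivity
  have hd : ∀ n, Monotone (d n) := fun n i j hij =>
    mul_le_mul_of_nonneg_right (by exact_mod_cast hij) (hTn n)
  have hd0 : ∀ n, d n 0 = 0 := fun n => by simp [d]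
  have hdn : ∀ n, d n (n + 1) = T := fun n => by
    have : (n + 1 : ℝ) ≠ 0 := by positivity
    simp only [d]; push_cast; field_simp
  set S : ℕ → ℝ → ℝ := fun n t =>
    ∑ i ∈ Finset.range (n + 1), A (min (d n i) t) (min (d n (i + 1)) t)
  have hbd : ∀ t ∈ Icc 0 T, ∀ n, |S n t - A 0 t| ≤ sewConst θ * K * t ^ θ := by
    intro t ht n
    have e := abs_sum_sub_le_of_almost_additive hθ hK hA'
      (r := fun i => min (d n i) t) (fun i j hij => min_le_min_right _ (hd n hij))
      (n + 1) 0 (n + 1) (by omega) (by omega) (by simp [hd0, ht.1]) (by simp [ht.2])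
    rw [← Finset.range_eq_Ico] at e
    simpa only [hd0, hdn, min_eq_left ht.1, min_eq_right ht.2, sub_zero] using e
  -- one ultrafilter for all `t`, so that the limits can be compared for different `t`
  have hlim : ∀ t ∈ Icc 0 T, ∃ x, Tendsto (fun n => S n t) (hyperfilter ℕ) (𝓝 x) := by
    intro t ht
    obtain ⟨x, -, hx⟩ := (isCompact_Icc (a := A 0 t - sewConst θ * K * t ^ θ)
      (b := A 0 t + sewConst θ * K * t ^ θ)).ultrafilter_le_nhds
      ((hyperfilter ℕ).map fun n => S n t) (by
        rw [Ultrafilter.coe_map, le_principal_iff]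
        refine Filter.mem_map.2 (univ_mem' fun n => ?_)
        have := abs_le.1 (hbd t ht n)
        constructor <;> linarith [this.1, this.2])
    exact ⟨x, hx⟩
  choose! J hJ using hlim
  have hJ0 : J 0 = 0 := by
    have h := hJ 0 ⟨le_rfl, hT⟩
    have hS : ∀ n, S n 0 = 0 := fun n => by
      refine Finset.sum_eq_zero fun i _ => ?_
      rw [min_eq_right (by rw [← hd0 n]; exact hd n (Nat.zero_le _)),
        min_eq_right (by rw [← hd0 n]; exact hd n (Nat.zero_le _)), hself]
    simp only [hS] at h
    exact (tendsto_nhds_unique h tendsto_const_nhds)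
  refine ⟨J, hJ0, sewConst θ * K, fun s t hs hst ht => ?_⟩
  have hsT : s ∈ Icc 0 T := ⟨hs, hst.trans ht⟩
  have htT : t ∈ Icc 0 T := ⟨hs.trans hst, ht⟩
  have hl1 := (((hJ t htT).sub (hJ s hsT)).sub_const (A s t)).abs
  have hl2 : Tendsto (fun n : ℕ => (K * T) * (T / (n + 1 : ℝ)) ^ (θ - 1) +
      sewConst θ * K * (t - s) ^ θ) (hyperfilter ℕ) (𝓝 (0 + sewConst θ * K * (t - s) ^ θ)) :=
    ((tendsto_mul_div_rpow hθ T (K * T)).mono_left Nat.hyperfilter_le_atTop).add_const _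
  rw [zero_add] at hl2
  refine le_of_tendsto_of_tendsto' hl1 hl2 fun n => ?_
  -- the part of the partition between `s` and `t`
  set r : ℕ → ℝ := fun i => max s (min (d n i) t)
  have hr : Monotone r := fun i j hij => max_le_max_left _ (min_le_min_right _ (hd n hij))
  have r0 : r 0 = s := by simp [r, hd0, hs]
  have rn : r (n + 1) = t := by simp [r, hdn, ht, hst]
  have e1 := abs_sum_sub_le_of_almost_additive hθ hK hA' hr (n + 1) 0 (n + 1) (by omega) (by omega)
    (by rw [r0]; exact hs) (by rw [rn]; exact ht)
  rw [← Finset.range_eq_Ico, r0, rn] at e1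
  -- only the cell that contains `s` contributes to the error
  have e2 : |S n t - S n s - ∑ i ∈ Finset.range (n + 1), A (r i) (r (i + 1))| ≤
      (K * T) * (T / (n + 1 : ℝ)) ^ (θ - 1) := by
    simp only [S]
    rw [← Finset.sum_sub_distrib, ← Finset.sum_sub_distrib]
    refine (Finset.abs_sum_le_sum_abs _ _).trans ?_
    have hcell : ∀ i ∈ Finset.range (n + 1), |A (min (d n i) t) (min (d n (i + 1)) t) -
        A (min (d n i) s) (min (d n (i + 1)) s) - A (r i) (r (i + 1))| ≤
          K * (T / (n + 1 : ℝ)) ^ θ := by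
      intro i hi
      have hnn : 0 ≤ K * (T / (n + 1 : ℝ)) ^ θ := mul_nonneg hK (Real.rpow_nonneg (hTn n) _)
      have hstep : d n (i + 1) = d n i + T / (n + 1 : ℝ) := by simp only [d]; push_cast; ring
      have hi0 : 0 ≤ d n i := by rw [← hd0 n]; exact hd n (Nat.zero_le _)
      have hle := hd n (Nat.le_succ i)
      simp only [Nat.succ_eq_add_one] at hle
      simp only [r]
      rcases le_total (d n (i + 1)) s with h | h
      · rw [min_eq_left (h.trans hst), min_eq_left (hle.trans (h.trans hst)), min_eq_left h,
          min_eq_left (hle.trans h), max_eq_left h, max_eq_left (hle.trans h), hself]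
        simpa using hnn
      rcases le_total s (d n i) with h' | h'
      · rw [min_eq_right h', min_eq_right h, hself, max_eq_right (le_min h' hst),
          max_eq_right (le_min h hst)]
        simpa using hnn
      · rw [min_eq_left (h'.trans hst), min_eq_left h', min_eq_right h, max_eq_left h',
          max_eq_right (le_min h hst)]
        refine (hA' _ _ _ hi0 h' (le_min h hst) ((min_le_right _ _).trans ht)).trans ?_
        refine mul_le_mul_of_nonneg_left (Real.rpow_le_rpow ?_ ?_ (by linarith)) hK
        · linarith [le_min h hst]
        · linarith [min_le_left (d n (i + 1)) t]
    refine (Finset.sum_le_sum hcell).trans (le_of_eq ?_)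
    rw [Finset.sum_const, Finset.card_range, nsmul_eq_mul]
    rcases hT.eq_or_lt with h | h
    · rw [← h]; simp [Real.zero_rpow (by linarith : θ ≠ 0)]
    · have hpos : 0 < T / (n + 1 : ℝ) := by positivity
      rw [Real.rpow_sub_one hpos.ne']
      push_cast
      field_simp
  rw [abs_le] at e1 e2
  rw [abs_le]
  constructor <;> linarith [e1.1, e1.2, e2.1, e2.2]

/-- Riemann sums over all partitions converge to the increments of a Young primitive. -/
theorem IsYoungPrimitive.isPathwiseIntegral {θ T t : ℝ} (hθ : 1 < θ) {f g J : ℝ → ℝ}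
    (hJ : IsYoungPrimitive θ T f g J) (ht : t ∈ Icc 0 T) :
    IsPathwiseIntegral f g t (J t - J 0) := by
  obtain ⟨C₀, hC₀⟩ := hJ
  set C := max C₀ 0
  have hC0 : 0 ≤ C := le_max_right _ _
  have hC : ∀ s t, 0 ≤ s → s ≤ t → t ≤ T →
      |J t - J s - f s * (g t - g s)| ≤ C * (t - s) ^ θ := fun s t h1 h2 h3 =>
    (hC₀ s t h1 h2 h3).trans (mul_le_mul_of_nonneg_right (le_max_left _ _)
      (Real.rpow_nonneg (by linarith) _))
  intro ε hε
  have hlim : Tendsto (fun δ : ℝ => C * δ ^ (θ - 1) * t) (𝓝[>] 0) (𝓝 0) := by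
    have h1 : Tendsto (fun δ : ℝ => δ) (𝓝[>] 0) (𝓝 0) := tendsto_id.mono_left nhdsWithin_le_nhds
    have h2 := ((h1.rpow_const (p := θ - 1) (Or.inr (by linarith))).const_mul C).mul_const t
    rwa [Real.zero_rpow (by linarith), mul_zero, zero_mul] at h2
  obtain ⟨δ, hδ, hδ0⟩ := ((hlim.eventually_lt_const hε).and self_mem_nhdsWithin).exists
  refine ⟨δ, hδ0, fun n s h0 hn hs => ?_⟩
  have e := abs_sum_sub_le_of_young (δ := δ) hθ hC0 hC n (r := s) h0.ge (hn.trans_le ht.2)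
    (fun i hi => ⟨(hs i hi).1.le, (hs i hi).2.le⟩)
  rw [hn, h0, sub_zero] at e
  exact e.trans_lt hδ

/-- The pathwise integral is unique, as there are partitions of arbitrarily small mesh. -/
theorem IsPathwiseIntegral.unique {f g : ℝ → ℝ} {t I₁ I₂ : ℝ} (ht : 0 ≤ t)
    (h₁ : IsPathwiseIntegral f g t I₁) (h₂ : IsPathwiseIntegral f g t I₂) : I₁ = I₂ := by
  by_contra hne
  have hpos : 0 < |I₁ - I₂| / 2 := by have := abs_pos.2 (sub_ne_zero.2 hne); linarith
  obtain ⟨δ₁, hδ₁, H₁⟩ := h₁ _ hpos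
  obtain ⟨δ₂, hδ₂, H₂⟩ := h₂ _ hpos
  obtain ⟨n, s, h0, hn, hs⟩ : ∃ (n : ℕ) (s : ℕ → ℝ), s 0 = 0 ∧ s n = t ∧
      ∀ i < n, s i < s (i + 1) ∧ s (i + 1) - s i < min δ₁ δ₂ := by
    rcases ht.eq_or_lt with rfl | ht
    · exact ⟨0, fun _ => 0, rfl, rfl, fun i hi => by omega⟩
    · obtain ⟨n, hn⟩ := exists_nat_gt (t / min δ₁ δ₂)
      have hm : 0 < min δ₁ δ₂ := lt_min hδ₁ hδ₂
      have hn0 : (0 : ℝ) < n := lt_trans (by positivity) hn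
      rw [div_lt_iff₀ hm] at hn
      refine ⟨n, fun i => i * (t / n), by simp, by field_simp, fun i _ => ?_⟩
      have hd : 0 < t / n := by positivity
      have hd2 : t / n < min δ₁ δ₂ := by rw [div_lt_iff₀ hn0]; linarith
      push_cast
      constructor <;> linarith
  have e₁ := H₁ n s h0 hn fun i hi => ⟨(hs i hi).1, (hs i hi).2.trans_le (min_le_left _ _)⟩
  have e₂ := H₂ n s h0 hn fun i hi => ⟨(hs i hi).1, (hs i hi).2.trans_le (min_le_right _ _)⟩
  rw [abs_lt] at e₁ e₂
  have : |I₁ - I₂| < |I₁ - I₂| := by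
    rw [abs_lt]; constructor <;> linarith [e₁.1, e₁.2, e₂.1, e₂.2]
  exact lt_irrefl _ this

/-! ### Weighted Hölder bounds -/

/-- A bound with exponential weight for a path `y` on `[0, T]` at the time scale `h`: both the
norm and the `α`-Hölder increments over times at most `h` apart are controlled by `ρ exp (t / h)`,
where time is measured in units of `h`. -/
structure WeightedBound {E : Type*} [NormedAddCommGroup E] (T α h ρ : ℝ) (y : ℝ → E) :
    Prop where
  norm_le : ∀ t ∈ Icc 0 T, ‖y t‖ ≤ ρ * Real.exp (t / h)
  sub_le : ∀ s t, 0 ≤ s → s ≤ t → t ≤ T → t - s ≤ h →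
    ‖y t - y s‖ ≤ ρ * Real.exp (t / h) * ((t - s) / h) ^ α

/-- `y` is `α`-Hölder on `[0, T]`. -/
def IsHolder {E : Type*} [NormedAddCommGroup E] (α T : ℝ) (y : ℝ → E) : Prop :=
  ∃ M, ∀ s t, 0 ≤ s → s ≤ t → t ≤ T → ‖y t - y s‖ ≤ M * (t - s) ^ α

/-- The coefficients of the equation `y(t) = y₀ + ∫₀ᵗ U[y](s) ds + (∫₀ᵗ f(s, y(s)) dg(s)) e`,
where the drift `U[y](s)` may depend on the past of `y` up to time `s`. -/
structure YoungVolterra {E : Type*} [NormedAddCommGroup E] [NormedSpace ℝ E] (T K : ℝ)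
    (f : ℝ → E → ℝ) (U : (ℝ → E) → ℝ → E) : Prop where
  f_growth : ∀ t ∈ Icc 0 T, ∀ y, |f t y| ≤ K * (1 + ‖y‖)
  f_lip : ∀ t ∈ Icc 0 T, ∀ x y, |f t x - f t y| ≤ K * ‖x - y‖
  f_time : ∀ s ∈ Icc 0 T, ∀ t ∈ Icc 0 T, ∀ y, |f t y - f s y| ≤ K * (1 + ‖y‖) * |t - s|
  f_rect : ∀ t ∈ Icc 0 T, ∀ y h k,
    |f t (y + h + k) - f t (y + h) - f t (y + k) + f t y| ≤ K * (‖h‖ * ‖k‖)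
  f_time_lip : ∀ s ∈ Icc 0 T, ∀ t ∈ Icc 0 T, ∀ x y,
    |f t x - f s x - (f t y - f s y)| ≤ K * (|t - s| * ‖x - y‖)
  U_growth : ∀ y, ContinuousOn y (Icc 0 T) → ∀ s ∈ Icc 0 T, ∀ M,
    (∀ u ∈ Icc 0 s, ‖y u‖ ≤ M) → ‖U y s‖ ≤ K * (1 + M)
  U_lip : ∀ x y, ContinuousOn x (Icc 0 T) → ContinuousOn y (Icc 0 T) → ∀ s ∈ Icc 0 T, ∀ R d,
    (∀ u ∈ Icc 0 s, ‖x u‖ ≤ R) → (∀ u ∈ Icc 0 s, ‖y u‖ ≤ R) →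
    (∀ u ∈ Icc 0 s, ‖x u - y u‖ ≤ d) → ‖U x s - U y s‖ ≤ K * (1 + R) * d
  U_integrable : ∀ y, ContinuousOn y (Icc 0 T) → IntervalIntegrable (U y) volume 0 T

/-- `z` is the image of `y` under the Picard map of the equation
`y(t) = y₀ + ∫₀ᵗ U[y](s) ds + (∫₀ᵗ f(s, y(s)) dg(s)) e` on `[0, T]`. -/
def IsPicardImage {E : Type*} [NormedAddCommGroup E] [NormedSpace ℝ E] (θ T : ℝ)
    (f : ℝ → E → ℝ) (U : (ℝ → E) → ℝ → E) (g : ℝ → ℝ) (e y₀ : E) (y z : ℝ → E) : Prop :=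
  ∃ J : ℝ → ℝ, J 0 = 0 ∧ IsYoungPrimitive θ T (fun s => f s (y s)) g J ∧
    ∀ t ∈ Icc 0 T, z t = y₀ + (∫ s in (0 : ℝ)..t, U y s) + J t • e

section

variable {E : Type*} [NormedAddCommGroup E]

theorem WeightedBound.of_tendsto {T α h ρ : ℝ} {y : ℕ → ℝ → E} {z : ℝ → E}
    (hy : ∀ n, WeightedBound T α h ρ (y n))
    (hz : ∀ t ∈ Icc 0 T, Tendsto (fun n => y n t) atTop (𝓝 (z t))) :
    WeightedBound T α h ρ z where
  norm_le t ht := le_of_tendsto' (hz t ht).norm fun n => (hy n).norm_le t ht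
  sub_le s t hs hst ht hh :=
    le_of_tendsto' ((hz t ⟨hs.trans hst, ht⟩).sub (hz s ⟨hs, hst.trans ht⟩)).norm
      fun n => (hy n).sub_le s t hs hst ht hh

theorem WeightedBound.mono {T α h ρ ρ' : ℝ} (hh : 0 < h) {y : ℝ → E}
    (hy : WeightedBound T α h ρ y) (hρ : ρ ≤ ρ') : WeightedBound T α h ρ' y where
  norm_le t ht := (hy.norm_le t ht).trans (by gcongr)
  sub_le s t hs hst ht hsh := (hy.sub_le s t hs hst ht hsh).trans (by
    have : 0 ≤ ((t - s) / h) ^ α := Real.rpow_nonneg (div_nonneg (by linarith) hh.le) _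
    gcongr)

/-- The increments at scale `h` control the weighted norm: over each step of length `h` the weight
grows by the factor `e ≥ 2`, so that the contributions of the steps form a geometric series. -/
theorem WeightedBound.of_sub_le {T α h a ρ : ℝ} (hα : 0 ≤ α) (hh : 0 < h) {y : ℝ → E}
    (ha : ‖y 0‖ ≤ a) (hρ : 0 ≤ ρ)
    (hy : ∀ s t, 0 ≤ s → s ≤ t → t ≤ T → t - s ≤ h →
      ‖y t - y s‖ ≤ ρ * Real.exp (t / h) * ((t - s) / h) ^ α) :
    WeightedBound T α h (2 * (a + ρ)) y := by
  have ha0 : 0 ≤ a := (norm_nonneg _).trans ha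
  have hinc : ∀ s t, 0 ≤ s → s ≤ t → t ≤ T → t - s ≤ h → ‖y t - y s‖ ≤ ρ * Real.exp (t / h) := by
    intro s t h1 h2 h3 h4
    refine (hy s t h1 h2 h3 h4).trans (mul_le_of_le_one_right (by positivity) ?_)
    exact Real.rpow_le_one (div_nonneg (by linarith) hh.le) ((div_le_one hh).2 h4) hα
  refine ⟨?_, fun s t h1 h2 h3 h4 => (hy s t h1 h2 h3 h4).trans ?_⟩
  · have main : ∀ n : ℕ, ∀ t, 0 ≤ t → t ≤ T → t ≤ (n + 1 : ℝ) * h →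
        ‖y t‖ ≤ 2 * (a + ρ) * Real.exp (t / h) := by
      have tri : ∀ s t, ‖y t‖ ≤ ‖y s‖ + ‖y t - y s‖ := fun s t => by
        have := norm_add_le (y s) (y t - y s)
        rwa [add_sub_cancel] at this
      have hbase : ∀ t, 0 ≤ t → t ≤ T → t ≤ h → ‖y t‖ ≤ 2 * (a + ρ) * Real.exp (t / h) := by
        intro t h0 hT hth
        have e1 := hinc 0 t le_rfl h0 hT (by linarith)
        have e2 : 1 ≤ Real.exp (t / h) := Real.one_le_exp (by positivity)
        have e3 := tri 0 t
        nlinarith [mul_nonneg ha0 (sub_nonneg.2 e2), mul_nonneg hρ (sub_nonneg.2 e2)]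
      intro n
      induction n with
      | zero => intro t h0 hT ht; exact hbase t h0 hT (by simpa using ht)
      | succ n ih =>
        intro t h0 hT ht
        rcases le_total t h with hth | hth
        · exact hbase t h0 hT hth
        push_cast at ht
        have e0 := ih (t - h) (by linarith) (by linarith) (by linarith)
        have e1 := hinc (t - h) t (by linarith) (by linarith) hT (by linarith)
        have e2 : Real.exp (t / h) = Real.exp ((t - h) / h) * Real.exp 1 := by
          rw [← Real.exp_add]; congr 1; field_simp; ring
        have e3 : 2 ≤ Real.exp 1 := by linarith [Real.add_one_le_exp (1 : ℝ)]
        have e4 : 2 * Real.exp ((t - h) / h) ≤ Real.exp (t / h) := by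
          rw [e2]; nlinarith [Real.exp_pos ((t - h) / h)]
        have e5 := tri (t - h) t
        nlinarith [mul_le_mul_of_nonneg_left e4 (by positivity : 0 ≤ a + ρ),
          mul_nonneg ha0 (Real.exp_pos (t / h)).le]
    intro t ht
    obtain ⟨n, hn⟩ := exists_nat_ge (t / h)
    rw [div_le_iff₀ hh] at hn
    exact main n t ht.1 ht.2 (by nlinarith)
  · have h5 : 0 ≤ ((t - s) / h) ^ α := Real.rpow_nonneg (div_nonneg (by linarith) hh.le) _
    gcongr
    linarith

theorem IsHolder.continuousOn {α T : ℝ} (hα : 0 < α) {y : ℝ → E} (hy : IsHolder α T y) :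
    ContinuousOn y (Icc 0 T) := by
  obtain ⟨M, hM⟩ := hy
  have hM' : ∀ s ∈ Icc 0 T, ∀ t ∈ Icc 0 T, dist (y t) (y s) ≤ M * |t - s| ^ α := by
    intro s hs t ht
    rw [dist_eq_norm]
    rcases le_total s t with h | h
    · rw [abs_of_nonneg (sub_nonneg.2 h)]; exact hM s t hs.1 h ht.2
    · rw [norm_sub_rev, abs_sub_comm, abs_of_nonneg (sub_nonneg.2 h)]; exact hM t s ht.1 h hs.2
  intro s hs
  rw [ContinuousWithinAt, tendsto_iff_dist_tendsto_zero]
  have hlim : Tendsto (fun t => M * |t - s| ^ α) (𝓝[Icc 0 T] s) (𝓝 0) := by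
    have h1 : Continuous fun t => M * |t - s| ^ α := by
      refine continuous_const.mul (Continuous.rpow_const (by fun_prop) fun _ => Or.inr hα.le)
    have h2 := (h1.tendsto s).mono_left (nhdsWithin_le_nhds (s := Icc 0 T))
    simpa [Real.zero_rpow hα.ne'] using h2
  exact squeeze_zero' (Eventually.of_forall fun _ => dist_nonneg)
    (eventually_nhdsWithin_of_forall fun t ht => hM' s hs t ht) hlim

theorem IsHolder.mono {α γ T : ℝ} (hα : 0 < α) (hαγ : α ≤ γ) {y : ℝ → E}
    (hy : IsHolder γ T y) : IsHolder α T y := by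
  obtain ⟨M, hM⟩ := hy
  refine ⟨max M 0 * T ^ (γ - α), fun s t hs hst ht => (hM s t hs hst ht).trans ?_⟩
  have h0 : 0 ≤ t - s := by linarith
  have e : (t - s) ^ γ = (t - s) ^ (γ - α) * (t - s) ^ α := by
    rw [← Real.rpow_add_of_nonneg h0 (by linarith) hα.le]; congr 1; ring
  calc M * (t - s) ^ γ ≤ max M 0 * (t - s) ^ γ :=
        mul_le_mul_of_nonneg_right (le_max_left _ _) (Real.rpow_nonneg h0 _)
    _ ≤ max M 0 * (T ^ (γ - α) * (t - s) ^ α) := by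
        rw [e]
        refine mul_le_mul_of_nonneg_left (mul_le_mul_of_nonneg_right
          (Real.rpow_le_rpow h0 (by linarith) (by linarith)) (Real.rpow_nonneg h0 _))
          (le_max_right _ _)
    _ = _ := by ring

theorem IsHolder.exists_norm_le {α T : ℝ} (hα : 0 ≤ α) {y : ℝ → E} (hy : IsHolder α T y) :
    ∃ R, 0 ≤ R ∧ ∀ t ∈ Icc 0 T, ‖y t‖ ≤ R := by
  obtain ⟨M, hM⟩ := hy
  refine ⟨max (‖y 0‖ + max M 0 * T ^ α) 0, le_max_right _ _, fun t ht => ?_⟩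
  refine le_trans ?_ (le_max_left _ _)
  have h1 := hM 0 t le_rfl ht.1 ht.2
  have h2 := norm_add_le (y 0) (y t - y 0)
  rw [add_sub_cancel] at h2
  have h3 : M * (t - 0) ^ α ≤ max M 0 * T ^ α := by
    rw [sub_zero]
    exact mul_le_mul (le_max_left _ _) (Real.rpow_le_rpow ht.1 ht.2 hα)
      (Real.rpow_nonneg ht.1 _) (le_max_right _ _)
  linarith

theorem IsHolder.sub {α T : ℝ} {x y : ℝ → E} (hx : IsHolder α T x) (hy : IsHolder α T y) :
    IsHolder α T (fun t => x t - y t) := by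
  obtain ⟨M, hM⟩ := hx
  obtain ⟨N, hN⟩ := hy
  refine ⟨M + N, fun s t hs hst ht => ?_⟩
  rw [sub_sub_sub_comm, add_mul]
  exact (norm_sub_le _ _).trans (add_le_add (hM s t hs hst ht) (hN s t hs hst ht))

/-- Bounds for the norm and the increments give a weighted bound at every scale `h ≤ 1`. -/
theorem WeightedBound.of_bounds {T α h R M : ℝ} (hα : 0 ≤ α) (hh : 0 < h) (hh1 : h ≤ 1)
    (hR : 0 ≤ R) (hM : 0 ≤ M) {y : ℝ → E} (hyR : ∀ t ∈ Icc 0 T, ‖y t‖ ≤ R)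
    (hyM : ∀ s t, 0 ≤ s → s ≤ t → t ≤ T → t - s ≤ h → ‖y t - y s‖ ≤ M * (t - s) ^ α) :
    WeightedBound T α h (R + M) y where
  norm_le t ht := by
    have e : 1 ≤ Real.exp (t / h) := Real.one_le_exp (div_nonneg ht.1 hh.le)
    have := hyR t ht
    nlinarith
  sub_le s t hs hst ht hsh := by
    have e : 1 ≤ Real.exp (t / h) := Real.one_le_exp (div_nonneg (hs.trans hst) hh.le)
    have h0 : 0 ≤ t - s := by linarith
    have e2 : (t - s) ^ α ≤ ((t - s) / h) ^ α :=
      Real.rpow_le_rpow h0 (le_div_self h0 hh hh1) hα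
    have e3 : 0 ≤ ((t - s) / h) ^ α := Real.rpow_nonneg (div_nonneg h0 hh.le) _
    calc _ ≤ M * (t - s) ^ α := hyM s t hs hst ht hsh
      _ ≤ M * ((t - s) / h) ^ α := mul_le_mul_of_nonneg_left e2 hM
      _ ≤ (R + M) * Real.exp (t / h) * ((t - s) / h) ^ α :=
        mul_le_mul_of_nonneg_right (by nlinarith) e3

theorem WeightedBound.nonneg {T α h ρ : ℝ} (hT : 0 ≤ T) {y : ℝ → E}
    (hy : WeightedBound T α h ρ y) : 0 ≤ ρ := by
  have := (norm_nonneg _).trans (hy.norm_le 0 ⟨le_rfl, hT⟩)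
  simpa using this

theorem WeightedBound.norm_le' {T α h ρ : ℝ} (hT : 0 ≤ T) (hh : 0 < h) {y : ℝ → E}
    (hy : WeightedBound T α h ρ y) (t : ℝ) (ht : t ∈ Icc 0 T) : ‖y t‖ ≤ ρ * Real.exp (T / h) := by
  refine (hy.norm_le t ht).trans (mul_le_mul_of_nonneg_left ?_ (hy.nonneg hT))
  exact Real.exp_le_exp.2 (div_le_div_of_nonneg_right ht.2 hh.le)

theorem WeightedBound.sub_le' {T α h ρ : ℝ} (hT : 0 ≤ T) (hh : 0 < h) {y : ℝ → E}
    (hy : WeightedBound T α h ρ y) (s t : ℝ) (hs : 0 ≤ s) (hst : s ≤ t) (ht : t ≤ T)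
    (hsh : t - s ≤ h) : ‖y t - y s‖ ≤ ρ * Real.exp (T / h) / h ^ α * (t - s) ^ α := by
  have h0 : 0 ≤ t - s := by linarith
  refine (hy.sub_le s t hs hst ht hsh).trans ?_
  rw [Real.div_rpow h0 hh.le, mul_div_assoc', div_mul_eq_mul_div]
  have hp : 0 < h ^ α := Real.rpow_pos_of_pos hh _
  have hp' : 0 ≤ (t - s) ^ α := Real.rpow_nonneg h0 _
  have := hy.nonneg hT
  gcongr

theorem WeightedBound.holder_le {T α h ρ : ℝ} (hα : 0 ≤ α) (hT : 0 ≤ T) (hh : 0 < h) {y : ℝ → E}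
    (hy : WeightedBound T α h ρ y) (s t : ℝ) (hs : 0 ≤ s) (hst : s ≤ t) (ht : t ≤ T) :
    ‖y t - y s‖ ≤ 2 * (ρ * Real.exp (T / h) / h ^ α) * (t - s) ^ α := by
  have h0 : 0 ≤ t - s := by linarith
  have hp : 0 < h ^ α := Real.rpow_pos_of_pos hh _
  have hp' : 0 ≤ (t - s) ^ α := Real.rpow_nonneg h0 _
  have hρ : 0 ≤ ρ * Real.exp (T / h) := mul_nonneg (hy.nonneg hT) (Real.exp_pos _).le
  rcases le_total (t - s) h with hsh | hsh
  · refine (hy.sub_le' hT hh s t hs hst ht hsh).trans (mul_le_mul_of_nonneg_right ?_ hp')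
    have : 0 ≤ ρ * Real.exp (T / h) / h ^ α := by positivity
    linarith
  · have e1 := hy.norm_le' hT hh t ⟨hs.trans hst, ht⟩
    have e2 := hy.norm_le' hT hh s ⟨hs, hst.trans ht⟩
    have e3 : 1 ≤ (t - s) ^ α / h ^ α := (one_le_div hp).2 (Real.rpow_le_rpow hh.le hsh hα)
    calc ‖y t - y s‖ ≤ 2 * (ρ * Real.exp (T / h)) * 1 := by
          linarith [norm_sub_le (y t) (y s)]
      _ ≤ 2 * (ρ * Real.exp (T / h)) * ((t - s) ^ α / h ^ α) := by gcongr
      _ = _ := by ring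

theorem WeightedBound.isHolder {T α h ρ : ℝ} (hα : 0 ≤ α) (hT : 0 ≤ T) (hh : 0 < h) {y : ℝ → E}
    (hy : WeightedBound T α h ρ y) : IsHolder α T y :=
  ⟨_, hy.holder_le hα hT hh⟩

variable [NormedSpace ℝ E]

/-- The basic estimate: at a small scale `h`, both `∫₀^· W ds` and `∫₀^· f dg` are small in the
weighted norm. -/
theorem WeightedBound.of_integral {T α β h κ m n Λ : ℝ} (hα : 0 < α) (hαβ : α ≤ β) (hβ : β ≤ 1)
    (hθ : 1 < α + β) (hT : 0 ≤ T) (hh : 0 < h) (hκ : 0 ≤ κ) (hm : 0 ≤ m) (hn : 0 ≤ n) (hΛ : 0 ≤ Λ)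
    {f g J : ℝ → ℝ} {W D : ℝ → E} {e D₀ : E} (he : ‖e‖ ≤ 1)
    (hg : ∀ s t, 0 ≤ s → s ≤ t → t ≤ T → |g t - g s| ≤ Λ * (t - s) ^ β)
    (hJ0 : J 0 = 0) (hJ : IsYoungPrimitive (α + β) T f g J)
    (hWi : IntervalIntegrable W volume 0 T)
    (hW : ∀ r ∈ Icc 0 T, ‖W r‖ ≤ κ * Real.exp (r / h))
    (hf : ∀ r ∈ Icc 0 T, |f r| ≤ m * Real.exp (r / h))
    (hf' : ∀ s t, 0 ≤ s → s ≤ t → t ≤ T → t - s ≤ h →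
      |f t - f s| ≤ n * Real.exp (t / h) * ((t - s) / h) ^ α)
    (hD : ∀ t ∈ Icc 0 T, D t = D₀ + (∫ s in (0 : ℝ)..t, W s) + J t • e) :
    WeightedBound T α h (2 * (‖D₀‖ + (κ * h + Λ * h ^ β * (m + sewConst (α + β) * n)))) D := by
  have hC := sewConst_pos hθ
  have hβ0 : 0 < β := hα.trans_le hαβ
  refine WeightedBound.of_sub_le hα.le hh ?_ (by positivity) ?_
  · rw [hD 0 ⟨le_rfl, hT⟩, hJ0]; simp
  intro s t hs hst ht hsh
  have hsT : s ∈ Icc 0 T := ⟨hs, hst.trans ht⟩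
  have htT : t ∈ Icc 0 T := ⟨hs.trans hst, ht⟩
  set x := (t - s) / h with hx
  have hx0 : 0 ≤ x := div_nonneg (by linarith) hh.le
  have hx1 : x ≤ 1 := (div_le_one hh).2 hsh
  have hts : t - s = h * x := by rw [hx]; field_simp
  set Ex := Real.exp (t / h)
  have hEx : 0 < Ex := Real.exp_pos _
  have hexp : ∀ r, r ≤ t → Real.exp (r / h) ≤ Ex := fun r hr =>
    Real.exp_le_exp.2 (div_le_div_of_nonneg_right hr hh.le)
  have hxα : 0 ≤ x ^ α := Real.rpow_nonneg hx0 _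
  -- the Lebesgue integral
  have i1 : IntervalIntegrable W volume 0 t := hWi.mono_set (by
    rw [uIcc_of_le htT.1, uIcc_of_le hT]; exact Icc_subset_Icc_right ht)
  have i2 : IntervalIntegrable W volume 0 s := hWi.mono_set (by
    rw [uIcc_of_le hs, uIcc_of_le hT]; exact Icc_subset_Icc_right hsT.2)
  have eW : ‖∫ r in s..t, W r‖ ≤ κ * h * Ex * x ^ α := by
    have e1 : ‖∫ r in s..t, W r‖ ≤ κ * Ex * |t - s| := by
      refine intervalIntegral.norm_integral_le_of_norm_le_const fun r hr => ?_
      rw [uIoc_of_le hst] at hr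
      exact (hW r ⟨hs.trans hr.1.le, hr.2.trans ht⟩).trans
        (mul_le_mul_of_nonneg_left (hexp r hr.2) hκ)
    rw [abs_of_nonneg (by linarith), hts] at e1
    have e2 : x ≤ x ^ α := by
      have := Real.rpow_le_rpow_of_exponent_ge_of_imp hx0 hx1 (hαβ.trans hβ)
        (fun _ h => absurd h one_ne_zero)
      simpa using this
    calc _ ≤ κ * Ex * (h * x) := e1
      _ = κ * h * Ex * x := by ring
      _ ≤ _ := mul_le_mul_of_nonneg_left e2 (by positivity)
  -- the Young integral
  have eJ : |J t - J s| ≤ Λ * h ^ β * (m + sewConst (α + β) * n) * Ex * x ^ α := by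
    have e1 := hJ.abs_sub_le hθ (K := n * Ex / h ^ α * Λ) (by positivity) hs hst ht
      (abs_germ_le (q := n * Ex / h ^ α) (Λ := Λ) hα.le hβ0.le (by positivity) hΛ
        (fun a u ha hau hut => by
          have h0 : 0 ≤ u - a := by linarith
          have := hf' a u (hs.trans ha) hau (hut.trans ht) (by linarith)
          rw [Real.div_rpow h0 hh.le] at this
          refine this.trans ?_
          have h1 := hexp u hut
          have h2 : 0 ≤ (u - a) ^ α / h ^ α := by positivity
          calc _ ≤ n * Ex * ((u - a) ^ α / h ^ α) := by gcongr
            _ = _ := by ring)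
        (fun a u ha hau hut => hg a u (hs.trans ha) hau (hut.trans ht)))
    have e2 : |f s * (g t - g s)| ≤ m * Ex * (Λ * (t - s) ^ β) := by
      rw [abs_mul]
      exact mul_le_mul ((hf s hsT).trans (mul_le_mul_of_nonneg_left (hexp s hst) hm))
        (hg s t hs hst ht) (abs_nonneg _) (by positivity)
    have e3 : (t - s) ^ β ≤ h ^ β * x ^ α := by
      rw [hts, Real.mul_rpow hh.le hx0]
      exact mul_le_mul_of_nonneg_left (Real.rpow_le_rpow_of_exponent_ge_of_imp hx0 hx1 hαβ
        (fun _ h => absurd h hβ0.ne')) (Real.rpow_nonneg hh.le _)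
    have e4 : (t - s) ^ (α + β) ≤ h ^ α * (h ^ β * x ^ α) := by
      rw [Real.rpow_add_of_nonneg (by linarith) hα.le hβ0.le]
      refine mul_le_mul (Real.rpow_le_rpow (by linarith) hsh hα.le) e3
        (Real.rpow_nonneg (by linarith) _) (Real.rpow_nonneg hh.le _)
    have e5 : sewConst (α + β) * (n * Ex / h ^ α * Λ) * (t - s) ^ (α + β) ≤
        Λ * h ^ β * (sewConst (α + β) * n) * Ex * x ^ α := by
      calc _ ≤ sewConst (α + β) * (n * Ex / h ^ α * Λ) * (h ^ α * (h ^ β * x ^ α)) :=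
            mul_le_mul_of_nonneg_left e4 (by positivity)
        _ = _ := by
          have : h ^ α ≠ 0 := (Real.rpow_pos_of_pos hh _).ne'
          field_simp
    have e6 : m * Ex * (Λ * (t - s) ^ β) ≤ Λ * h ^ β * m * Ex * x ^ α := by
      calc _ ≤ m * Ex * (Λ * (h ^ β * x ^ α)) := by gcongr
        _ = _ := by ring
    have e7 : |J t - J s| ≤ |J t - J s - f s * (g t - g s)| + |f s * (g t - g s)| := by
      have := abs_add_le (J t - J s - f s * (g t - g s)) (f s * (g t - g s))
      rwa [sub_add_cancel] at this
    linarith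
  have e : D t - D s = (∫ r in s..t, W r) + (J t - J s) • e := by
    rw [hD t htT, hD s hsT, ← intervalIntegral.integral_interval_sub_left i1 i2, sub_smul]
    abel
  rw [e]
  refine (norm_add_le _ _).trans ?_
  rw [norm_smul, Real.norm_eq_abs]
  have := mul_le_of_le_one_right (abs_nonneg (J t - J s)) he
  linarith

end

/-! ### Young–Volterra equations -/

section

variable {E : Type*} [NormedAddCommGroup E] [NormedSpace ℝ E] {T K : ℝ} {f : ℝ → E → ℝ}
  {U : (ℝ → E) → ℝ → E}

/-- The increments of `f` along two paths. Apart from the increment of the difference of the paths,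
they only involve the second-order increments of `f` over a parallelogram. -/
theorem YoungVolterra.abs_sub_sub_le (hf : YoungVolterra T K f U) {s t : ℝ}
    (hs : s ∈ Icc 0 T) (ht : t ∈ Icc 0 T) (x x' y y' : E) :
    |f t x' - f t y' - (f s x - f s y)| ≤
      K * (‖x' - y' - (x - y)‖ + ‖x - y‖ * ‖y' - y‖ + |t - s| * ‖x - y‖) := by
  -- the fourth vertex of the parallelogram spanned by `x - y` and `y' - y` at `y` replaces `x'`
  have e1 := hf.f_lip t ht x' (y + (x - y) + (y' - y))
  have e2 := hf.f_rect t ht y (x - y) (y' - y)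
  have e3 := hf.f_time_lip s hs t ht x y
  have a1 : x' - (y + (x - y) + (y' - y)) = x' - y' - (x - y) := by abel
  have a2 : y + (x - y) = x := by abel
  have a3 : y + (y' - y) = y' := by abel
  rw [a1] at e1
  rw [a3] at e2
  rw [a2] at e1 e2
  rw [mul_add, mul_add]
  rw [abs_le] at *
  constructor <;> linarith [e1.1, e1.2, e2.1, e2.2, e3.1, e3.2]

theorem YoungVolterra.isHolder_comp (hf : YoungVolterra T K f U) (hK : 0 ≤ K) {α : ℝ}
    (hα : 0 < α) (hα1 : α ≤ 1) {y : ℝ → E} (hy : IsHolder α T y) :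
    ∃ q, 0 ≤ q ∧ ∀ s t, 0 ≤ s → s ≤ t → t ≤ T → |f t (y t) - f s (y s)| ≤ q * (t - s) ^ α := by
  obtain ⟨R, hR0, hR⟩ := hy.exists_norm_le hα.le
  obtain ⟨N, hN⟩ := (show IsHolder 1 T fun t : ℝ => t from
    ⟨1, fun s t _ h _ => by rw [Real.norm_of_nonneg (by linarith)]; simp⟩).mono hα hα1
  obtain ⟨M, hM⟩ := hy
  refine ⟨max (K * M + K * (1 + R) * N) 0, le_max_right _ _, fun s t hs hst ht => ?_⟩
  have hp : 0 ≤ (t - s) ^ α := Real.rpow_nonneg (by linarith) _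
  refine le_trans ?_ (mul_le_mul_of_nonneg_right (le_max_left _ _) hp)
  have e1 := hf.f_lip t ⟨hs.trans hst, ht⟩ (y t) (y s)
  have e2 := hf.f_time s ⟨hs, hst.trans ht⟩ t ⟨hs.trans hst, ht⟩ (y s)
  have e3 := mul_le_mul_of_nonneg_left (hM s t hs hst ht) hK
  have e4 : K * (1 + ‖y s‖) * |t - s| ≤ K * (1 + R) * (N * (t - s) ^ α) := by
    have := hR s ⟨hs, hst.trans ht⟩
    have h2 := hN s t hs hst ht
    rw [Real.norm_eq_abs] at h2
    gcongr
  have e5 := abs_sub_le (f t (y t)) (f t (y s)) (f s (y s))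
  linarith

theorem YoungVolterra.exists_young (hf : YoungVolterra T K f U) (hK : 0 ≤ K) (hT : 0 ≤ T)
    {α β Λ : ℝ} (hα : 0 < α) (hα1 : α ≤ 1) (hβ : 0 ≤ β) (hθ : 1 < α + β) (hΛ : 0 ≤ Λ) {g : ℝ → ℝ}
    (hg : ∀ s t, 0 ≤ s → s ≤ t → t ≤ T → |g t - g s| ≤ Λ * (t - s) ^ β) {y : ℝ → E}
    (hy : IsHolder α T y) :
    ∃ J : ℝ → ℝ, J 0 = 0 ∧ IsYoungPrimitive (α + β) T (fun s => f s (y s)) g J := by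
  obtain ⟨q, hq, h⟩ := hf.isHolder_comp hK hα hα1 hy
  exact exists_isYoungPrimitive hθ (mul_nonneg hq hΛ) hT (abs_germ_le hα.le hβ hq hΛ h hg)

/-- A weighted ball which the Picard map preserves. The radius is affine in `y₀`, and the scale
`h` depends on the driving path only through `Λ * h ^ β`. -/
theorem YoungVolterra.picard_mem_ball (hf : YoungVolterra T K f U) (hK : 0 ≤ K) (hT : 0 ≤ T)
    {β Λ h : ℝ} (hβ : 1 / 2 < β) (hβ1 : β ≤ 1) (hΛ : 0 ≤ Λ) (hh : 0 < h) (hh1 : h ≤ 1)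
    (hsmall : K * h + K * (Λ * h ^ β) * (1 + 2 * sewConst (β + β)) ≤ 1 / 8) {g : ℝ → ℝ}
    (hg : ∀ s t, 0 ≤ s → s ≤ t → t ≤ T → |g t - g s| ≤ Λ * (t - s) ^ β) {e y₀ : E}
    (he : ‖e‖ ≤ 1) {y z : ℝ → E} (hy : WeightedBound T β h (1 + 4 * ‖y₀‖) y)
    (hz : IsPicardImage (β + β) T f U g e y₀ y z) :
    WeightedBound T β h (1 + 4 * ‖y₀‖) z := by
  obtain ⟨J, hJ0, hJ, hzJ⟩ := hz
  have hβ0 : 0 < β := by linarith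
  have hC := sewConst_pos (θ := β + β) (by linarith)
  have hyc := (hy.isHolder hβ0.le hT hh).continuousOn hβ0
  set R := 1 + 4 * ‖y₀‖ with hR
  have hR0 : 0 ≤ R := by positivity
  have hexp : ∀ r, 0 ≤ r → 1 ≤ Real.exp (r / h) := fun r hr =>
    Real.one_le_exp (div_nonneg hr hh.le)
  have hpt : ∀ r ∈ Icc 0 T, K * (1 + ‖y r‖) ≤ K * (1 + R) * Real.exp (r / h) := fun r hr => by
    have e1 := hy.norm_le r hr
    have e2 := hexp r hr.1
    rw [mul_assoc]
    exact mul_le_mul_of_nonneg_left (by linarith) hK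
  have key := WeightedBound.of_integral (κ := K * (1 + R)) (m := K * (1 + R))
    (n := 2 * (K * (1 + R))) (Λ := Λ) (h := h)
    hβ0 le_rfl hβ1 (by linarith) hT hh (by positivity) (by positivity) (by positivity) hΛ he hg
    hJ0 hJ
    (hf.U_integrable y hyc) (fun r hr => by
      refine (hf.U_growth y hyc r hr (R * Real.exp (r / h)) fun u hu => ?_).trans ?_
      · exact (hy.norm_le u ⟨hu.1, hu.2.trans hr.2⟩).trans (mul_le_mul_of_nonneg_left
          (Real.exp_le_exp.2 (div_le_div_of_nonneg_right hu.2 hh.le)) hR0)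
      · rw [mul_assoc]
        exact mul_le_mul_of_nonneg_left (by linarith [hexp r hr.1]) hK)
    (fun r hr => (hf.f_growth r hr _).trans (hpt r hr))
    (fun s t hs hst ht hsh => by
      have e1 := hf.f_lip t ⟨hs.trans hst, ht⟩ (y t) (y s)
      have e2 := hf.f_time s ⟨hs, hst.trans ht⟩ t ⟨hs.trans hst, ht⟩ (y s)
      have e3 := abs_sub_le (f t (y t)) (f t (y s)) (f s (y s))
      have e4 := mul_le_mul_of_nonneg_left (hy.sub_le s t hs hst ht hsh) hK
      have hx0 : 0 ≤ (t - s) / h := div_nonneg (by linarith) hh.le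
      have e5 : t - s ≤ ((t - s) / h) ^ β := by
        refine (le_div_self (by linarith) hh hh1).trans ?_
        simpa using Real.rpow_le_rpow_of_exponent_ge_of_imp hx0 ((div_le_one hh).2 hsh) hβ1
          (fun _ h => absurd h one_ne_zero)
      have e6 : Real.exp (s / h) ≤ Real.exp (t / h) :=
        Real.exp_le_exp.2 (div_le_div_of_nonneg_right hst hh.le)
      have e7 : K * (1 + ‖y s‖) * |t - s| ≤
          K * (1 + R) * Real.exp (t / h) * ((t - s) / h) ^ β := by
        rw [abs_of_nonneg (by linarith)]
        have := (hpt s ⟨hs, hst.trans ht⟩).trans (mul_le_mul_of_nonneg_left e6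
          (by positivity : 0 ≤ K * (1 + R)))
        exact mul_le_mul this e5 (by linarith) (by positivity)
      have e8 : 0 ≤ K * Real.exp (t / h) * ((t - s) / h) ^ β := by positivity
      nlinarith) hzJ
  have hle : 2 * (‖y₀‖ + (K * (1 + R) * h + Λ * h ^ β *
      (K * (1 + R) + sewConst (β + β) * (2 * (K * (1 + R)))))) ≤ R := by
    have e : K * (1 + R) * h + Λ * h ^ β *
        (K * (1 + R) + sewConst (β + β) * (2 * (K * (1 + R)))) =
      (1 + R) * (K * h + K * (Λ * h ^ β) * (1 + 2 * sewConst (β + β))) := by ring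
    rw [e]
    have := mul_le_mul_of_nonneg_left hsmall (by positivity : 0 ≤ 1 + R)
    rw [hR] at *
    linarith [norm_nonneg y₀]
  exact key.mono hh hle

/-- The Picard map is a contraction in the weighted norm at a scale `h` which is small in terms of
bounds for the two paths. -/
theorem YoungVolterra.picard_contract (hf : YoungVolterra T K f U) (hK : 0 ≤ K) (hT : 0 ≤ T)
    {α β Λ h R M ρ : ℝ} (hα : 0 < α) (hαβ : α ≤ β) (hβ : β ≤ 1) (hθ : 1 < α + β)
    (hΛ : 0 ≤ Λ) (hh : 0 < h) (hh1 : h ≤ 1) (hR : 0 ≤ R) (hM : 0 ≤ M)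
    (hsmall : K * (1 + R) * h + Λ * h ^ β * (K + sewConst (α + β) * (K * (2 + M))) ≤ 1 / 4)
    {g : ℝ → ℝ} (hg : ∀ s t, 0 ≤ s → s ≤ t → t ≤ T → |g t - g s| ≤ Λ * (t - s) ^ β) {e y₀ : E}
    (he : ‖e‖ ≤ 1) {y₁ y₂ z₁ z₂ : ℝ → E} (hy₁ : ContinuousOn y₁ (Icc 0 T))
    (hy₂ : ContinuousOn y₂ (Icc 0 T)) (hR₁ : ∀ t ∈ Icc 0 T, ‖y₁ t‖ ≤ R)
    (hR₂ : ∀ t ∈ Icc 0 T, ‖y₂ t‖ ≤ R)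
    (hM₂ : ∀ s t, 0 ≤ s → s ≤ t → t ≤ T → t - s ≤ h → ‖y₂ t - y₂ s‖ ≤ M * (t - s) ^ α)
    (hz₁ : IsPicardImage (α + β) T f U g e y₀ y₁ z₁)
    (hz₂ : IsPicardImage (α + β) T f U g e y₀ y₂ z₂)
    (hd : WeightedBound T α h ρ (fun t => y₁ t - y₂ t)) :
    WeightedBound T α h (ρ / 2) (fun t => z₁ t - z₂ t) := by
  obtain ⟨J₁, hJ₁0, hJ₁, hz₁⟩ := hz₁
  obtain ⟨J₂, hJ₂0, hJ₂, hz₂⟩ := hz₂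
  have hC := sewConst_pos hθ
  have hρ := hd.nonneg hT
  have key := WeightedBound.of_integral (κ := K * (1 + R) * ρ) (m := K * ρ)
    (n := K * (ρ * (2 + M))) (Λ := Λ) (h := h) (D₀ := 0)
    (f := fun s => f s (y₁ s) - f s (y₂ s)) (J := fun s => J₁ s - J₂ s)
    (W := fun s => U y₁ s - U y₂ s) (D := fun t => z₁ t - z₂ t)
    hα hαβ hβ hθ hT hh (by positivity) (by positivity) (by positivity) hΛ he hg
    (by simp [hJ₁0, hJ₂0]) (hJ₁.sub hJ₂)
    ((hf.U_integrable y₁ hy₁).sub (hf.U_integrable y₂ hy₂)) (fun r hr => by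
      refine (hf.U_lip y₁ y₂ hy₁ hy₂ r hr R (ρ * Real.exp (r / h))
        (fun u hu => hR₁ u ⟨hu.1, hu.2.trans hr.2⟩) (fun u hu => hR₂ u ⟨hu.1, hu.2.trans hr.2⟩)
        fun u hu => ?_).trans (by rw [← mul_assoc])
      exact (hd.norm_le u ⟨hu.1, hu.2.trans hr.2⟩).trans (mul_le_mul_of_nonneg_left
          (Real.exp_le_exp.2 (div_le_div_of_nonneg_right hu.2 hh.le)) hρ))
    (fun r hr => (hf.f_lip r hr _ _).trans (by
      rw [mul_assoc]; exact mul_le_mul_of_nonneg_left (hd.norm_le r hr) hK))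
    (fun s t hs hst ht hsh => by
      have hsT : s ∈ Icc 0 T := ⟨hs, hst.trans ht⟩
      have h0 : 0 ≤ t - s := by linarith
      have hx0 : 0 ≤ (t - s) / h := div_nonneg h0 hh.le
      refine (hf.abs_sub_sub_le hsT ⟨hs.trans hst, ht⟩ (y₁ s) (y₁ t) (y₂ s) (y₂ t)).trans ?_
      have e1 := hd.sub_le s t hs hst ht hsh
      have e2 : ‖y₁ s - y₂ s‖ ≤ ρ * Real.exp (t / h) := (hd.norm_le s hsT).trans
        (mul_le_mul_of_nonneg_left
          (Real.exp_le_exp.2 (div_le_div_of_nonneg_right hst hh.le)) hρ)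
      have e3 : ‖y₂ t - y₂ s‖ ≤ M * ((t - s) / h) ^ α := (hM₂ s t hs hst ht hsh).trans
        (mul_le_mul_of_nonneg_left (Real.rpow_le_rpow h0 (le_div_self h0 hh hh1) hα.le) hM)
      have e4 : |t - s| ≤ ((t - s) / h) ^ α := by
        rw [abs_of_nonneg h0]
        refine (le_div_self h0 hh hh1).trans ?_
        simpa using Real.rpow_le_rpow_of_exponent_ge_of_imp hx0 ((div_le_one hh).2 hsh)
          (hαβ.trans hβ) (fun _ h => absurd h one_ne_zero)
      have hx : 0 ≤ ((t - s) / h) ^ α := Real.rpow_nonneg hx0 _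
      have hE : 0 ≤ ρ * Real.exp (t / h) := by positivity
      have e5 := mul_le_mul e2 e3 (norm_nonneg _) hE
      have e6 := mul_le_mul e4 e2 (norm_nonneg _) hx
      have e7 : ρ * (2 + M) * Real.exp (t / h) * ((t - s) / h) ^ α =
        ρ * Real.exp (t / h) * ((t - s) / h) ^ α +
        ρ * Real.exp (t / h) * (M * ((t - s) / h) ^ α) +
        ((t - s) / h) ^ α * (ρ * Real.exp (t / h)) := by ring
      rw [mul_assoc K, mul_assoc K, e7]
      exact mul_le_mul_of_nonneg_left (by linarith) hK)
    (fun t ht => by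
      have i1 : ∀ y, ContinuousOn y (Icc 0 T) → IntervalIntegrable (U y) volume 0 t := fun y hy =>
        (hf.U_integrable y hy).mono_set (by
          rw [uIcc_of_le ht.1, uIcc_of_le hT]; exact Icc_subset_Icc_right ht.2)
      rw [hz₁ t ht, hz₂ t ht, intervalIntegral.integral_sub (i1 _ hy₁) (i1 _ hy₂), sub_smul]
      abel)
  have hle : 2 * (‖(0 : E)‖ + (K * (1 + R) * ρ * h + Λ * h ^ β *
      (K * ρ + sewConst (α + β) * (K * (ρ * (2 + M)))))) ≤ ρ / 2 := by
    rw [norm_zero]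
    have := mul_le_mul_of_nonneg_left hsmall hρ
    linarith
  exact key.mono hh hle

theorem exists_small_scale {β a b h₀ : ℝ} (hβ : 0 < β) (h₀0 : 0 < h₀) :
    ∃ h, 0 < h ∧ h ≤ h₀ ∧ a * h + h ^ β * b ≤ 1 / 4 := by
  have hlim : Tendsto (fun h : ℝ => a * h + h ^ β * b) (𝓝[>] 0) (𝓝 0) := by
    have h1 : Tendsto (fun h : ℝ => h) (𝓝[>] 0) (𝓝 0) := tendsto_id.mono_left nhdsWithin_le_nhds
    have h2 := (h1.const_mul a).add ((h1.rpow_const (p := β) (Or.inr hβ.le)).mul_const b)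
    simpa [Real.zero_rpow hβ.ne'] using h2
  obtain ⟨h, h1, h2, h3⟩ := ((hlim.eventually_lt_const (by norm_num : (0 : ℝ) < 1 / 4)).and
    ((eventually_nhdsWithin_of_eventually_nhds (eventually_le_nhds h₀0)).and
      self_mem_nhdsWithin)).exists
  exact ⟨h, h3, h2, h1.le⟩

theorem tendsto_div_two_pow_mul (c x : ℝ) :
    Tendsto (fun n : ℕ => c / 2 ^ n * x) atTop (𝓝 0) := by
  have := (tendsto_pow_atTop_nhds_zero_of_lt_one (r := (1 / 2 : ℝ)) (by norm_num)
    (by norm_num)).const_mul c |>.mul_const x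
  simpa [div_eq_mul_inv] using this

/-- Hölder solutions are unique. -/
theorem YoungVolterra.unique (hf : YoungVolterra T K f U) (hK : 0 ≤ K) (hT : 0 ≤ T)
    {α β Λ : ℝ} (hα : 0 < α) (hαβ : α ≤ β) (hβ : β ≤ 1) (hθ : 1 < α + β)
    (hΛ : 0 ≤ Λ) {g : ℝ → ℝ} (hg : ∀ s t, 0 ≤ s → s ≤ t → t ≤ T → |g t - g s| ≤ Λ * (t - s) ^ β)
    {e y₀ : E} (he : ‖e‖ ≤ 1) {y₁ y₂ : ℝ → E} (hy₁ : IsHolder α T y₁) (hy₂ : IsHolder α T y₂)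
    (hz₁ : IsPicardImage (α + β) T f U g e y₀ y₁ y₁)
    (hz₂ : IsPicardImage (α + β) T f U g e y₀ y₂ y₂) (t : ℝ) (ht : t ∈ Icc 0 T) :
    y₁ t = y₂ t := by
  obtain ⟨R₁, hR₁0, hR₁⟩ := hy₁.exists_norm_le hα.le
  obtain ⟨R₂, hR₂0, hR₂⟩ := hy₂.exists_norm_le hα.le
  obtain ⟨R₃, hR₃0, hR₃⟩ := (hy₁.sub hy₂).exists_norm_le hα.le
  obtain ⟨N, hN⟩ := hy₁.sub hy₂
  obtain ⟨M₀, hM₀⟩ := id hy₂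
  have hM₂ : ∀ s t, 0 ≤ s → s ≤ t → t ≤ T → ‖y₂ t - y₂ s‖ ≤ max M₀ 0 * (t - s) ^ α :=
    fun s t h1 h2 h3 => (hM₀ s t h1 h2 h3).trans (mul_le_mul_of_nonneg_right (le_max_left _ _)
      (Real.rpow_nonneg (by linarith) _))
  obtain ⟨h, hh, hh1, hsmall⟩ := exists_small_scale (β := β) (a := K * (1 + max R₁ R₂))
    (b := Λ * (K + sewConst (α + β) * (K * (2 + max M₀ 0)))) (hα.trans_le hαβ) one_pos
  have h0 : WeightedBound T α h (R₃ + max N 0) (fun t => y₁ t - y₂ t) :=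
    WeightedBound.of_bounds hα.le hh hh1 hR₃0 (le_max_right _ _) hR₃ fun s t h1 h2 h3 _ =>
      (hN s t h1 h2 h3).trans (mul_le_mul_of_nonneg_right (le_max_left _ _)
        (Real.rpow_nonneg (by linarith) _))
  have hn : ∀ n : ℕ, WeightedBound T α h ((R₃ + max N 0) / 2 ^ n) (fun t => y₁ t - y₂ t) := by
    intro n
    induction n with
    | zero => simpa using h0
    | succ n ih =>
      rw [pow_succ, ← div_div]
      exact hf.picard_contract hK hT hα hαβ hβ hθ hΛ hh hh1 (hR₁0.trans (le_max_left _ _))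
        (le_max_right M₀ 0) (by rw [mul_comm Λ, mul_assoc (h ^ β)]; exact hsmall) hg he
        (hy₁.continuousOn hα) (hy₂.continuousOn hα)
        (fun t ht => (hR₁ t ht).trans (le_max_left _ _))
        (fun t ht => (hR₂ t ht).trans (le_max_right _ _))
        (fun s t h1 h2 h3 _ => hM₂ s t h1 h2 h3) hz₁ hz₂ ih
  exact sub_eq_zero.1 (norm_le_zero_iff.1
    (ge_of_tendsto' (tendsto_div_two_pow_mul _ _) fun n => (hn n).norm_le t ht))

/-- Existence by Picard iteration inside the invariant ball. Any two tails of the iteration start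
in the ball, so that the `n`-th iterates differ by at most `ρ / 2 ^ n` in the weighted norm of the
contraction scale. -/
theorem YoungVolterra.exists_solution [CompleteSpace E] (hf : YoungVolterra T K f U) (hK : 0 ≤ K)
    (hT : 0 ≤ T) {β Λ h : ℝ} (hβ : 1 / 2 < β) (hβ1 : β ≤ 1) (hΛ : 0 ≤ Λ) (hh : 0 < h) (hh1 : h ≤ 1)
    (hsmall : K * h + K * (Λ * h ^ β) * (1 + 2 * sewConst (β + β)) ≤ 1 / 8) {g : ℝ → ℝ}
    (hg : ∀ s t, 0 ≤ s → s ≤ t → t ≤ T → |g t - g s| ≤ Λ * (t - s) ^ β) {e : E} (y₀ : E)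
    (he : ‖e‖ ≤ 1) :
    ∃ y : ℝ → E, WeightedBound T β h (1 + 4 * ‖y₀‖) y ∧
      IsPicardImage (β + β) T f U g e y₀ y y := by
  have hβ0 : 0 < β := by linarith
  have hθ : 1 < β + β := by linarith
  set Ball : (ℝ → E) → Prop := WeightedBound T β h (1 + 4 * ‖y₀‖)
  have himage : ∀ y, Ball y → ∃ z, IsPicardImage (β + β) T f U g e y₀ y z := fun y hy => by
    obtain ⟨J, hJ0, hJ⟩ := hf.exists_young hK hT hβ0 hβ1 hβ0.le hθ hΛ hg
      (hy.isHolder hβ0.le hT hh)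
    exact ⟨_, J, hJ0, hJ, fun t _ => rfl⟩
  choose! P hP using himage
  have hPB : ∀ y, Ball y → Ball (P y) := fun y hy =>
    hf.picard_mem_ball hK hT hβ hβ1 hΛ hh hh1 hsmall hg he hy (hP y hy)
  have hball0 : Ball fun _ => y₀ := by
    have hE : ∀ t, 0 ≤ t → 1 ≤ Real.exp (t / h) := fun t ht =>
      Real.one_le_exp (div_nonneg ht hh.le)
    refine ⟨fun t ht => ?_, fun s t hs hst ht _ => ?_⟩
    · nlinarith [hE t ht.1, norm_nonneg y₀]
    · rw [sub_self, norm_zero]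
      have : 0 ≤ ((t - s) / h) ^ β := Real.rpow_nonneg (div_nonneg (by linarith) hh.le) _
      positivity
  set Y : ℕ → ℝ → E := fun n => P^[n] fun _ => y₀
  have hYs : ∀ n, Y (n + 1) = P (Y n) := fun n => Function.iterate_succ_apply' P n _
  have hYB : ∀ n, Ball (Y n) := fun n => by
    induction n with
    | zero => exact hball0
    | succ n ih => rw [hYs]; exact hPB _ ih
  -- uniform bounds on the ball and the contraction scale `k`
  set R := (1 + 4 * ‖y₀‖) * Real.exp (T / h)
  have hR0 : 0 ≤ R := by positivity
  set M := R / h ^ β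
  have hM0 : 0 ≤ M := by positivity
  have hBR : ∀ y, Ball y → ∀ t ∈ Icc 0 T, ‖y t‖ ≤ R := fun y hy => hy.norm_le' hT hh
  have hBM : ∀ y, Ball y → ∀ s t, 0 ≤ s → s ≤ t → t ≤ T → t - s ≤ h →
    ‖y t - y s‖ ≤ M * (t - s) ^ β := fun y hy => hy.sub_le' hT hh
  have hBc : ∀ y, Ball y → ContinuousOn y (Icc 0 T) := fun y hy =>
    (hy.isHolder hβ0.le hT hh).continuousOn hβ0
  obtain ⟨k, hk, hkh, hks⟩ := exists_small_scale (β := β) (a := K * (1 + R))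
    (b := Λ * (K + sewConst (β + β) * (K * (2 + M)))) hβ0 hh
  have hdiff : ∀ x y, Ball x → Ball y →
      WeightedBound T β k (2 * R + 2 * M) (fun t => x t - y t) := fun x y hx hy => by
    refine WeightedBound.of_bounds hβ0.le hk (hkh.trans hh1) (by positivity) (by positivity)
      (fun t ht => ?_) (fun s t hs hst ht hsk => ?_)
    · exact (norm_sub_le _ _).trans (by linarith [hBR x hx t ht, hBR y hy t ht])
    · rw [sub_sub_sub_comm]
      have e1 := hBM x hx s t hs hst ht (hsk.trans hkh)
      have e2 := hBM y hy s t hs hst ht (hsk.trans hkh)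
      exact (norm_sub_le _ _).trans (by linarith)
  have hcontr : ∀ x y x' y' ρ, Ball x → Ball y → IsPicardImage (β + β) T f U g e y₀ x x' →
      IsPicardImage (β + β) T f U g e y₀ y y' → WeightedBound T β k ρ (fun t => x t - y t) →
      WeightedBound T β k (ρ / 2) (fun t => x' t - y' t) := fun x y x' y' ρ hx hy hx' hy' hd =>
    hf.picard_contract hK hT hβ0 le_rfl hβ1 hθ hΛ hk (hkh.trans hh1) hR0 hM0
      (by rw [mul_comm Λ, mul_assoc (k ^ β)]; exact hks) hg he (hBc x hx) (hBc y hy)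
      (hBR x hx) (hBR y hy) (fun s t hs hst ht hsk => hBM y hy s t hs hst ht (hsk.trans hkh))
      hx' hy' hd
  -- `Y m` and `Y 0` are both in the ball, and each application of the map halves the distance
  have htail : ∀ n m, WeightedBound T β k ((2 * R + 2 * M) / 2 ^ n)
      (fun t => Y (m + n) t - Y n t) := by
    intro n
    induction n with
    | zero => intro m; simpa using hdiff _ _ (hYB m) (hYB 0)
    | succ n ih =>
      intro m
      rw [pow_succ, ← div_div, ← add_assoc, hYs, hYs]
      exact hcontr _ _ _ _ _ (hYB _) (hYB _) (hP _ (hYB _)) (hP _ (hYB _)) (ih m)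
  have hlim : ∀ t ∈ Icc 0 T, ∃ x, Tendsto (fun n => Y n t) atTop (𝓝 x) := by
    intro t ht
    refine cauchySeq_tendsto_of_complete ?_
    refine cauchySeq_of_le_tendsto_0' (fun n => (2 * R + 2 * M) / 2 ^ n * Real.exp (t / k))
      (fun n m hnm => ?_) ?_
    · obtain ⟨l, rfl⟩ := Nat.exists_eq_add_of_le' hnm
      rw [dist_comm, dist_eq_norm]
      exact (htail n l).norm_le t ht
    · exact tendsto_div_two_pow_mul _ _
  choose! y hy using hlim
  have hyB : Ball y := WeightedBound.of_tendsto hYB hy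
  refine ⟨y, hyB, ?_⟩
  have hyn : ∀ n, WeightedBound T β k ((2 * R + 2 * M) / 2 ^ n) (fun t => y t - Y n t) := fun n =>
    WeightedBound.of_tendsto (htail n) fun t ht =>
      ((tendsto_add_atTop_iff_nat n).2 (hy t ht)).sub_const _
  obtain ⟨J, hJ0, hJ, hPJ⟩ := hP y hyB
  refine ⟨J, hJ0, hJ, fun t ht => ?_⟩
  rw [← hPJ t ht]
  have h1 : ∀ n, WeightedBound T β k ((2 * R + 2 * M) / 2 ^ n)
      (fun t => P y t - Y (n + 1) t) := fun n => by
    have h2 := hcontr _ _ _ _ _ hyB (hYB n) (hP y hyB) (hP _ (hYB n)) (hyn n)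
    rw [← hYs] at h2
    have h3 : 0 ≤ (2 * R + 2 * M) / 2 ^ n := by positivity
    exact h2.mono hk (half_le_self h3)
  have h4 : Tendsto (fun n => Y (n + 1) t) atTop (𝓝 (P y t)) := by
    rw [tendsto_iff_dist_tendsto_zero]
    refine squeeze_zero (fun _ => dist_nonneg) (fun n => ?_)
      (tendsto_div_two_pow_mul (2 * R + 2 * M) (Real.exp (t / k)))
    rw [dist_comm, dist_eq_norm]
    exact (h1 n).norm_le t ht
  exact tendsto_nhds_unique ((tendsto_add_atTop_iff_nat 1).2 (hy t ht)) h4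

end

/-! ### Primitives, ℋ-derivatives and the increments of the coefficients -/

section

variable {T p : ℝ} [Fact (1 < p)]

theorem HpSpace.intervalIntegrable (g : HpSpace T p) {r : ℝ} (hr : r ∈ Icc 0 T) :
    IntervalIntegrable g volume 0 r := by
  rw [intervalIntegrable_iff_integrableOn_Icc_of_le hr.1]
  exact g.integrableOn.mono_set (Icc_subset_Icc_right hr.2)

theorem primitive_apply (g : HpSpace T p) (r : Icc (0 : ℝ) T) :
    primitive g r = ∫ u in (0 : ℝ)..r, g u := rfl

theorem primitive_congr {g : HpSpace T p} {f : ℝ → ℝ}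
    (h : g =ᵐ[volume.restrict (Icc 0 T)] f) (r : Icc (0 : ℝ) T) :
    primitive g r = ∫ u in (0 : ℝ)..r, f u := by
  rw [primitive_apply]
  refine intervalIntegral.integral_congr_ae ?_
  rw [EventuallyEq, ae_restrict_iff' measurableSet_Icc] at h
  filter_upwards [h] with u hu hur
  rw [uIoc_of_le r.2.1] at hur
  exact hu ⟨hur.1.le, hur.2.trans r.2.2⟩

theorem primitive_add (g h : HpSpace T p) : primitive (g + h) = primitive g + primitive h := by
  ext r
  rw [primitive_congr (Lp.coeFn_add g h), ContinuousMap.add_apply, primitive_apply, primitive_apply]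
  exact intervalIntegral.integral_add (g.intervalIntegrable r.2) (h.intervalIntegrable r.2)

theorem primitive_smul (c : ℝ) (g : HpSpace T p) : primitive (c • g) = c • primitive g := by
  ext r
  rw [primitive_congr (Lp.coeFn_smul c g), ContinuousMap.smul_apply, primitive_apply]
  exact intervalIntegral.integral_smul c _

theorem primitive_zero : primitive (0 : HpSpace T p) = 0 := by
  have := primitive_smul 0 (0 : HpSpace T p)
  rwa [zero_smul, zero_smul] at this

theorem primitive_sub (g h : HpSpace T p) : primitive (g - h) = primitive g - primitive h := by
  have := primitive_add (g - h) h
  rw [sub_add_cancel] at this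
  rw [this, add_sub_cancel_right]

theorem exists_norm_primitive_le (T p : ℝ) [hp : Fact (1 < p)] :
    ∃ C, 0 ≤ C ∧ ∀ g : HpSpace T p, ‖primitive g‖ ≤ C * ‖g‖ := by
  set μ := (volume : Measure ℝ).restrict (Icc (0 : ℝ) T)
  set a := μ univ ^ (1 / (1 : ℝ≥0∞).toReal - 1 / (ENNReal.ofReal p).toReal)
  have hp0 : 0 < p := zero_lt_one.trans hp.out
  have ha : a ≠ ∞ := by
    refine ENNReal.rpow_ne_top_of_nonneg ?_ (measure_ne_top μ univ)
    rw [ENNReal.toReal_ofReal hp0.le, ENNReal.toReal_one, sub_nonneg, div_le_div_iff₀ hp0 one_pos]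
    linarith [hp.out]
  refine ⟨a.toReal, ENNReal.toReal_nonneg, fun g => ?_⟩
  rw [ContinuousMap.norm_le _ (by positivity)]
  intro r
  have e1 : ‖primitive g r‖ ≤ ∫ u, ‖g u‖ ∂μ := by
    rw [primitive_apply]
    refine (intervalIntegral.norm_integral_le_integral_norm r.2.1).trans ?_
    rw [intervalIntegral.integral_of_le r.2.1]
    exact setIntegral_mono_set g.integrableOn.norm (ae_of_all _ fun _ => norm_nonneg _)
      (Ioc_subset_Icc_self.trans (Icc_subset_Icc_right r.2.2)).eventuallyLE
  refine e1.trans ?_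
  have e2 : eLpNorm g 1 μ ≤ eLpNorm g (ENNReal.ofReal p) μ * a :=
    eLpNorm_le_eLpNorm_mul_rpow_measure_univ Fact.out (Lp.memLp g).1
  have e3 := ENNReal.toReal_mono (ENNReal.mul_ne_top (Lp.memLp g).2.ne ha) e2
  rw [ENNReal.toReal_mul, ← Lp.norm_def, eLpNorm_one_eq_lintegral_enorm,
    ← integral_norm_eq_lintegral_enorm (Lp.memLp g).1] at e3
  linarith

theorem continuous_primitive : Continuous (primitive (T := T) (p := p)) := by
  obtain ⟨C, hC, h⟩ := exists_norm_primitive_le T p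
  refine (LipschitzWith.of_dist_le_mul (K := ⟨C, hC⟩) fun x y => ?_).continuous
  rw [dist_eq_norm, dist_eq_norm, ← primitive_sub]
  exact h _

end

section

variable {T p : ℝ} [Fact (1 < p)] {E : Type*} [NormedAddCommGroup E] [NormedSpace ℝ E]

theorem HDifferentiable.hasHDerivAt {F : PathSpace T → E} (hF : HDifferentiable p F)
    (ω : PathSpace T) : HasHDerivAt F (hDeriv p F ω) ω := by
  have h := hF ω
  rw [hDeriv, dif_pos h]
  exact h.choose_spec

theorem HasHDerivAt.hasDerivAt {F : PathSpace T → E} {D : PathSpace T → HpSpace T p →L[ℝ] E}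
    (hF : ∀ ω, HasHDerivAt F (D ω) ω) (ω : PathSpace T) (h : HpSpace T p) (r : ℝ) :
    HasDerivAt (fun ε : ℝ => F (ω + ε • primitive h)) (D (ω + r • primitive h) h) r := by
  have h1 := hF (ω + r • primitive h) h
  have h2 : HasDerivAt (fun ε : ℝ => ε - r) 1 r := (hasDerivAt_id r).sub_const r
  have h3 := HasDerivAt.scomp_of_eq r h1 h2 (sub_self r).symm
  rw [one_smul] at h3
  refine h3.congr_of_eventuallyEq (Eventually.of_forall fun ε => ?_)
  simp only [Function.comp]
  rw [add_assoc, ← add_smul, add_sub_cancel]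

/-- The mean value inequality in the directions of `ℋ_p`. -/
theorem norm_sub_le_of_hasHDerivAt {F : PathSpace T → E} {D : PathSpace T → HpSpace T p →L[ℝ] E}
    {C : ℝ} (hF : ∀ ω, HasHDerivAt F (D ω) ω) (hD : ∀ ω, ‖D ω‖ ≤ C) (ω : PathSpace T)
    (h : HpSpace T p) : ‖F (ω + primitive h) - F ω‖ ≤ C * ‖h‖ := by
  have := norm_image_sub_le_of_norm_deriv_le_segment_01'
    (f := fun ε : ℝ => F (ω + ε • primitive h)) (C := C * ‖h‖)
    (fun r _ => (HasHDerivAt.hasDerivAt hF ω h r).hasDerivWithinAt)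
    (fun r _ => ContinuousLinearMap.le_of_opNorm_le _ (hD _) h)
  simpa using this

theorem HasHDerivAt.sub {F G : PathSpace T → E} {D D' : HpSpace T p →L[ℝ] E} {ω : PathSpace T}
    (hF : HasHDerivAt F D ω) (hG : HasHDerivAt G D' ω) :
    HasHDerivAt (fun ω => F ω - G ω) (D - D') ω := fun h => (hF h).sub (hG h)

theorem HasHDerivAt.comp_add {F : PathSpace T → E} {D : HpSpace T p →L[ℝ] E} {ω v : PathSpace T}
    (hF : HasHDerivAt F D (ω + v)) : HasHDerivAt (fun ω => F (ω + v)) D ω := fun h => by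
  have := hF h
  simpa only [add_right_comm] using this

theorem abs_sub_le_of_deriv_le {F : ℝ → ℝ} {C : ℝ} (hF : Differentiable ℝ F)
    (hC : ∀ x, |deriv F x| ≤ C) (x y : ℝ) : |F x - F y| ≤ C * |x - y| :=
  convex_univ.norm_image_sub_le_of_norm_deriv_le (fun x _ => hF x) (fun x _ => hC x)
    (mem_univ y) (mem_univ x)

end

namespace CoefficientHypothesis

variable {T p H L : ℝ} [Fact (1 < p)] {b σ : ℝ → ℝ → PathSpace T → ℝ}
  (hc : CoefficientHypothesis T p H L b σ) {t : ℝ} (ht : t ∈ Icc 0 T)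
include hc ht

theorem b_sub_le (x y : ℝ) (ω : PathSpace T) (h : HpSpace T p) :
    |b t x (ω + primitive h) - b t y ω| ≤ L * (|x - y| + ‖h‖) := by
  have e1 := abs_sub_le_of_deriv_le ((hc.b_contDiff t ht ω).differentiable one_ne_zero)
    (fun x => hc.b_partialX t ht x ω) x y
  have e2 := norm_sub_le_of_hasHDerivAt (hc.b_hDifferentiable t ht x).hasHDerivAt
    (hc.b_hDeriv t ht x) ω h
  rw [Real.norm_eq_abs] at e2
  have := abs_sub_le (b t x (ω + primitive h)) (b t x ω) (b t y ω)
  linarith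

theorem σ_differentiableX (ω : PathSpace T) : Differentiable ℝ fun x => σ t x ω :=
  (hc.σ_contDiff t ht ω).differentiable two_ne_zero

theorem partialX_differentiable (ω : PathSpace T) :
    Differentiable ℝ fun x => partialX σ t x ω := by
  have h := hc.σ_contDiff t ht ω
  rw [show (2 : WithTop ℕ∞) = 1 + 1 from rfl, contDiff_succ_iff_deriv] at h
  exact h.2.2.differentiable one_ne_zero

theorem abs_partialX_le (x : ℝ) (ω : PathSpace T) : |partialX σ t x ω| ≤ L :=
  (le_add_of_nonneg_right (abs_nonneg _)).trans (hc.σ_partialX t ht x ω)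

theorem norm_hDeriv_le (x : ℝ) (ω : PathSpace T) : ‖hDeriv p (σ t x) ω‖ ≤ L :=
  (le_add_of_nonneg_right (norm_nonneg (hDeriv p (hDeriv p (σ t x)) ω))).trans
    (hc.σ_hDeriv t ht x ω)

theorem σ_sub_le (x y : ℝ) (ω : PathSpace T) (h : HpSpace T p) :
    |σ t x (ω + primitive h) - σ t y ω| ≤ L * (|x - y| + ‖h‖) := by
  have e1 := abs_sub_le_of_deriv_le (hc.σ_differentiableX ht ω)
    (fun x => hc.abs_partialX_le ht x ω) x y
  have e2 := norm_sub_le_of_hasHDerivAt (hc.σ_hDifferentiable t ht x).hasHDerivAt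
    (hc.norm_hDeriv_le ht x) ω h
  rw [Real.norm_eq_abs] at e2
  have := abs_sub_le (σ t x (ω + primitive h)) (σ t x ω) (σ t y ω)
  linarith

theorem partialX_sub_le_left (x y : ℝ) (ω : PathSpace T) :
    |partialX σ t x ω - partialX σ t y ω| ≤ L * |x - y| :=
  abs_sub_le_of_deriv_le (hc.partialX_differentiable ht ω)
    (fun x => (le_add_of_nonneg_left (abs_nonneg _)).trans (hc.σ_partialX t ht x ω)) x y

theorem partialX_sub_le_right (x : ℝ) (ω : PathSpace T) (h : HpSpace T p) :
    |partialX σ t x (ω + primitive h) - partialX σ t x ω| ≤ L * ‖h‖ :=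
  norm_sub_le_of_hasHDerivAt (hc.σ_partialX_hDifferentiable t ht x).hasHDerivAt
    (hc.σ_partialX_hDeriv t ht x) ω h

theorem partialX_sub_le (x y : ℝ) (ω : PathSpace T) (h : HpSpace T p) :
    |partialX σ t x (ω + primitive h) - partialX σ t y ω| ≤ L * (|x - y| + ‖h‖) := by
  have e1 := hc.partialX_sub_le_left ht x y ω
  have e2 := hc.partialX_sub_le_right ht x ω h
  have := abs_sub_le (partialX σ t x (ω + primitive h)) (partialX σ t x ω) (partialX σ t y ω)
  linarith

/-- Second-order increments in `x`, from the bound for `σ_xx`. -/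
theorem σ_rect_xx (x y a : ℝ) (ω : PathSpace T) :
    |σ t (x + a) ω - σ t x ω - (σ t (y + a) ω - σ t y ω)| ≤ L * (|a| * |x - y|) := by
  have hd := hc.σ_differentiableX ht ω
  have := abs_sub_le_of_deriv_le (F := fun x => σ t (x + a) ω - σ t x ω) (C := L * |a|)
    ((hd.comp (differentiable_id.add_const a)).sub hd) (fun x => by
      have h1 := ((hd (x + a)).hasDerivAt.comp_add_const x a).fun_sub (hd x).hasDerivAt
      rw [h1.deriv]
      simpa [partialX] using hc.partialX_sub_le_left ht (x + a) x ω) x y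
  rwa [mul_assoc] at this

/-- Mixed second-order increments, from the bound for `𝔻σ_x`. -/
theorem σ_rect_xh (x y : ℝ) (ω : PathSpace T) (h : HpSpace T p) :
    |σ t x (ω + primitive h) - σ t x ω - (σ t y (ω + primitive h) - σ t y ω)| ≤
      L * (‖h‖ * |x - y|) := by
  have hd := hc.σ_differentiableX ht ω
  have hd' := hc.σ_differentiableX ht (ω + primitive h)
  have := abs_sub_le_of_deriv_le (F := fun x => σ t x (ω + primitive h) - σ t x ω)
    (C := L * ‖h‖) (hd'.sub hd) (fun x => by
      rw [((hd' x).hasDerivAt.fun_sub (hd x).hasDerivAt).deriv]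
      exact hc.partialX_sub_le_right ht x ω h) x y
  rwa [mul_assoc] at this

theorem hDeriv_sub_le_right (x : ℝ) (ω : PathSpace T) (h : HpSpace T p) :
    ‖hDeriv p (σ t x) (ω + primitive h) - hDeriv p (σ t x) ω‖ ≤ L * ‖h‖ :=
  norm_sub_le_of_hasHDerivAt (hc.σ_hDifferentiable₂ t ht x).hasHDerivAt
    (fun ω => (le_add_of_nonneg_left (norm_nonneg _)).trans (hc.σ_hDeriv t ht x ω)) ω h

/-- `𝔻σ` is Lipschitz in `x`, as the mixed second-order increments of `σ` are bounded. -/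
theorem hDeriv_sub_le_left (hL : 0 ≤ L) (x y : ℝ) (ω : PathSpace T) :
    ‖hDeriv p (σ t x) ω - hDeriv p (σ t y) ω‖ ≤ L * |x - y| := by
  refine ContinuousLinearMap.opNorm_le_bound _ (by positivity) fun h => ?_
  have hd := ((hc.σ_hDifferentiable t ht x).hasHDerivAt ω).sub
    ((hc.σ_hDifferentiable t ht y).hasHDerivAt ω) h
  refine hd.le_of_lip' (by positivity) (Eventually.of_forall fun ε => ?_)
  have := hc.σ_rect_xh ht x y ω (ε • h)
  rw [primitive_smul, norm_smul] at this
  rw [zero_smul, add_zero, sub_zero, Real.norm_eq_abs]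
  calc _ = |σ t x (ω + ε • primitive h) - σ t x ω -
        (σ t y (ω + ε • primitive h) - σ t y ω)| := by congr 1; ring
    _ ≤ _ := this
    _ = _ := by ring

/-- Second-order increments in the directions of `ℋ_p`, from the bound for `𝔻²σ`. -/
theorem σ_rect_hh (x : ℝ) (ω : PathSpace T) (h k : HpSpace T p) :
    |σ t x (ω + primitive h + primitive k) - σ t x (ω + primitive h) -
      (σ t x (ω + primitive k) - σ t x ω)| ≤ L * (‖k‖ * ‖h‖) := by
  have := norm_sub_le_of_hasHDerivAt (F := fun ω => σ t x (ω + primitive k) - σ t x ω)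
    (C := L * ‖k‖) (fun ω => ((hc.σ_hDifferentiable t ht x).hasHDerivAt _).comp_add.sub
      ((hc.σ_hDifferentiable t ht x).hasHDerivAt ω))
    (fun ω => hc.hDeriv_sub_le_right ht x ω k) ω h
  rwa [mul_assoc] at this

theorem dPhi_sub_le (hL : 0 ≤ L) (x y : ℝ) (ω : PathSpace T) (h : HpSpace T p) :
    |dPhi p H t (σ t x) (ω + primitive h) - dPhi p H t (σ t y) ω| ≤
      L * (|x - y| + ‖h‖) * ‖phiH T p H t‖ := by
  rw [dPhi, dPhi, ← sub_apply, ← Real.norm_eq_abs]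
  refine ContinuousLinearMap.le_of_opNorm_le _ ?_ _
  have e1 := hc.hDeriv_sub_le_right ht x ω h
  have e2 := hc.hDeriv_sub_le_left ht hL x y ω
  have e3 := norm_sub_le_norm_sub_add_norm_sub (hDeriv p (σ t x) (ω + primitive h))
    (hDeriv p (σ t x) ω) (hDeriv p (σ t y) ω)
  linarith

theorem abs_partialT_le (x : ℝ) (ω : PathSpace T) : |partialT σ t x ω| ≤ L * (1 + |x|) := by
  have h1 := hc.σ_partialT t ht x 0 ω 0
  have h2 := hc.σ_partialT_zero t ht ω
  rw [primitive_zero, add_zero, sub_zero, norm_zero, add_zero] at h1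
  have := abs_add_le (partialT σ t x ω - partialT σ t 0 ω) (partialT σ t 0 ω)
  rw [sub_add_cancel] at this
  linarith

variable {s : ℝ} (hs : s ∈ Icc 0 T)
include hs

theorem σ_time_le (x : ℝ) (ω : PathSpace T) :
    |σ t x ω - σ s x ω| ≤ L * (1 + |x|) * |t - s| :=
  (convex_Icc 0 T).norm_image_sub_le_of_norm_hasDerivWithin_le
    (f' := fun r => partialT σ r x ω)
    (fun _ hr => (hc.σ_differentiable x ω _ hr).hasDerivWithinAt)
    (fun _ hr => hc.abs_partialT_le hr x ω) hs ht

theorem σ_time_sub_le (x y : ℝ) (ω : PathSpace T) (h : HpSpace T p) :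
    |σ t x (ω + primitive h) - σ s x (ω + primitive h) - (σ t y ω - σ s y ω)| ≤
      L * (|x - y| + ‖h‖) * |t - s| := by
  have := (convex_Icc 0 T).norm_image_sub_le_of_norm_hasDerivWithin_le
    (f := fun r => σ r x (ω + primitive h) - σ r y ω)
    (f' := fun r => partialT σ r x (ω + primitive h) - partialT σ r y ω)
    (fun _ hr => ((hc.σ_differentiable x _ _ hr).hasDerivWithinAt).sub
      (hc.σ_differentiable y ω _ hr).hasDerivWithinAt)
    (fun r hr => hc.σ_partialT r hr x y ω h) hs ht
  simp only [Real.norm_eq_abs] at this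
  convert this using 2
  ring

end CoefficientHypothesis

/-! ### The characteristic system as a Young–Volterra equation -/

section

variable {T p H : ℝ} [Fact (1 < p)]

theorem phiH_ae_eq (hH1 : H < 1) (hp : p < 1 / (2 - 2 * H)) (s : ℝ) :
    phiH T p H s =ᵐ[volume.restrict (Icc 0 T)] phi H s := by
  have h := memLp_phi (T := T) (p := p) hH1 hp s
  rw [phiH, dif_pos h]
  exact h.coeFn_toLp

/-- `s ↦ φ(s, ·)` is continuous into `L^p`: it is a restriction of translates of a single `L^p`
function, and translation is continuous in `L^p`. -/
theorem continuousOn_phiH (hH1 : H < 1) (hp : p < 1 / (2 - 2 * H)) :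
    ContinuousOn (phiH T p H) (Icc 0 T) := by
  have : Fact (ENNReal.ofReal p ≠ ∞) := ⟨ENNReal.ofReal_ne_top⟩
  -- `φ(s, u) = φ(T, T - s + u)`, and `T - s + u ∈ [0, 2T]` for `s, u ∈ [0, T]`
  have hk : MemLp ((Icc 0 (2 * T)).indicator (phi H T)) (ENNReal.ofReal p) volume :=
    (memLp_indicator_iff_restrict measurableSet_Icc).2 (memLp_phi hH1 hp T)
  set k := hk.toLp
  have hcont : Continuous fun s : ℝ => LpToLpRestrictCLM ℝ ℝ ℝ volume (ENNReal.ofReal p)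
      (Icc 0 T) (DomAddAct.mk (T - s) +ᵥ k) := by
    refine (LpToLpRestrictCLM ℝ ℝ ℝ volume (ENNReal.ofReal p) (Icc 0 T)).continuous.comp ?_
    have h1 : Continuous fun s : ℝ => (DomAddAct.mk (T - s) : ℝᵈᵃᵃ) :=
      DomAddAct.continuous_mk.comp (by fun_prop)
    exact h1.vadd continuous_const
  refine hcont.continuousOn.congr fun s hs => ?_
  refine Lp.ext ?_
  have e1 := LpToLpRestrictCLM_coeFn (μ := volume) ℝ (Icc 0 T) (DomAddAct.mk (T - s) +ᵥ k)
  have e2 : (DomAddAct.mk (T - s) +ᵥ k : Lp ℝ (ENNReal.ofReal p) volume) =ᵐ[volume]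
      fun u => (Icc 0 (2 * T)).indicator (phi H T) (T - s + u) := by
    rw [DomAddAct.mk_vadd_toLp]
    exact MemLp.coeFn_toLp _
  filter_upwards [e1, ae_restrict_of_ae e2, phiH_ae_eq (T := T) (p := p) hH1 hp s,
    ae_restrict_mem measurableSet_Icc] with u h1 h2 h3 hu
  have hmem : T - s + u ∈ Icc 0 (2 * T) := by
    constructor <;> linarith [hs.1, hs.2, hu.1, hu.2]
  rw [h1, h2, h3, indicator_of_mem hmem, phi, phi]
  congr 3
  ring

theorem phi_nonneg (hH : 1 / 2 < H) (s u : ℝ) : 0 ≤ phi H s u := by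
  have : 0 ≤ H * (2 * H - 1) := mul_nonneg (by linarith) (by linarith)
  exact mul_nonneg this (Real.rpow_nonneg (abs_nonneg _) _)

theorem intervalIntegrable_phi (hH1 : H < 1) (hp : p < 1 / (2 - 2 * H)) {s : ℝ}
    (hs : s ∈ Icc 0 T) : IntervalIntegrable (phi H s) volume 0 s := by
  rw [intervalIntegrable_iff_integrableOn_Icc_of_le hs.1]
  exact IntegrableOn.mono_set ((memLp_phi (T := T) hH1 hp s).integrable Fact.out)
    (Icc_subset_Icc_right hs.2)

/-- The kernel `φ` is bounded in `L^p`, uniformly in `s`, and so are the integrals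
`∫₀ˢ φ(s, u) du`. -/
theorem exists_phi_bound (T p H : ℝ) [Fact (1 < p)] (hH1 : H < 1) (hp : p < 1 / (2 - 2 * H)) :
    ∃ C, 0 ≤ C ∧ ∀ s ∈ Icc 0 T, ‖phiH T p H s‖ ≤ C ∧ ∫ u in (0 : ℝ)..s, phi H s u ≤ C := by
  obtain ⟨C₁, hC₁⟩ := isCompact_Icc.exists_bound_of_continuousOn
    (continuousOn_phiH (T := T) (p := p) hH1 hp)
  obtain ⟨C₂, hC₂0, hC₂⟩ := exists_norm_primitive_le T p
  refine ⟨max (max C₁ 0) (C₂ * C₁), le_max_of_le_left (le_max_right _ _), fun s hs => ⟨?_, ?_⟩⟩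
  · exact (hC₁ s hs).trans (le_max_of_le_left (le_max_left _ _))
  · rw [← primitive_congr (phiH_ae_eq (T := T) (p := p) hH1 hp s) ⟨s, hs⟩]
    refine le_max_of_le_right ((le_abs_self _).trans ?_)
    exact ((primitive (phiH T p H s)).norm_coe_le_norm ⟨s, hs⟩).trans ((hC₂ _).trans
      (mul_le_mul_of_nonneg_left (hC₁ s hs) hC₂0))

theorem intervalIntegrable_mul_phi (hH1 : H < 1) (hp : p < 1 / (2 - 2 * H)) {s m : ℝ}
    (hs : s ∈ Icc 0 T) {w : ℝ → ℝ} (hw : AEStronglyMeasurable w (volume.restrict (Icc 0 T)))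
    (hm : ∀ u ∈ Icc 0 s, |w u| ≤ m) :
    IntervalIntegrable (fun u => w u * phi H s u) volume 0 s := by
  have h := intervalIntegrable_phi (T := T) (p := p) hH1 hp hs
  rw [intervalIntegrable_iff_integrableOn_Icc_of_le hs.1] at h ⊢
  refine Integrable.bdd_mul (c := m) h (hw.mono_measure (Measure.restrict_mono
    (Icc_subset_Icc_right hs.2) le_rfl)) ?_
  filter_upwards [ae_restrict_mem measurableSet_Icc] with u hu using hm u hu

theorem abs_integral_mul_phi_le (hH : 1 / 2 < H) (hH1 : H < 1) (hp : p < 1 / (2 - 2 * H))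
    {s m C : ℝ} (hs : s ∈ Icc 0 T) (hC : ∫ u in (0 : ℝ)..s, phi H s u ≤ C) {w : ℝ → ℝ}
    (hm0 : 0 ≤ m) (hm : ∀ u ∈ Icc 0 s, |w u| ≤ m) :
    |∫ u in (0 : ℝ)..s, w u * phi H s u| ≤ m * C := by
  have h := intervalIntegrable_phi (T := T) (p := p) hH1 hp hs
  have e := intervalIntegral.norm_integral_le_of_norm_le (f := fun u => w u * phi H s u) hs.1
    (ae_of_all _ fun u hu => by
      rw [Real.norm_eq_abs, abs_mul, abs_of_nonneg (phi_nonneg hH s u)]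
      exact mul_le_mul_of_nonneg_right (hm u ⟨hu.1.le, hu.2⟩) (phi_nonneg hH s u))
    (h.const_mul m)
  rw [intervalIntegral.integral_const_mul] at e
  exact e.trans (mul_le_mul_of_nonneg_left hC hm0)

theorem aestronglyMeasurable_integral_mul_phi (T H : ℝ) {w : ℝ → ℝ}
    (hw : AEStronglyMeasurable w (volume.restrict (Icc 0 T))) :
    AEStronglyMeasurable (fun s => ∫ u in (0 : ℝ)..s, w u * phi H s u)
      (volume.restrict (Icc 0 T)) := by
  have hset : MeasurableSet {q : ℝ × ℝ | 0 < q.2 ∧ q.2 ≤ q.1} :=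
    (measurableSet_lt measurable_const measurable_snd).inter
      (measurableSet_le measurable_snd measurable_fst)
  have hphi : Measurable fun q : ℝ × ℝ => phi H q.1 q.2 := by unfold phi; fun_prop
  have h := ((hw.comp_snd (μ := volume.restrict (Icc 0 T))).mul
    hphi.aestronglyMeasurable).indicator hset |>.integral_prod_right'
  refine h.congr ?_
  filter_upwards [ae_restrict_mem measurableSet_Icc] with s hs
  rw [intervalIntegral.integral_of_le hs.1]
  have e : ∀ u, indicator {q : ℝ × ℝ | 0 < q.2 ∧ q.2 ≤ q.1}
      ((fun q => w q.2) * fun q : ℝ × ℝ => phi H q.1 q.2) (s, u) =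
      (Ioc 0 s).indicator (fun u => w u * phi H s u) u := fun u => by
    simp only [indicator, mem_ofPred_eq, mem_Ioc, Pi.mul_apply]
  simp only [e]
  rw [integral_indicator measurableSet_Ioc, Measure.restrict_restrict measurableSet_Ioc,
    inter_eq_left.2 (Ioc_subset_Icc_self.trans (Icc_subset_Icc_right hs.2))]

end

/-- The coefficient `σ` as a function on the state space `ℝ × ℋ_p` of `(z, Γ - ω)`. -/
noncomputable def diffusion {T p : ℝ} [Fact (1 < p)] (σ : ℝ → ℝ → PathSpace T → ℝ)
    (ω : PathSpace T) (t : ℝ) (y : ℝ × HpSpace T p) : ℝ :=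
  σ t y.1 (ω + primitive y.2)

/-- The integrands of the Lebesgue integrals in the system, as a functional of the path of
`(z, Γ - ω)`. -/
noncomputable def drift {T p : ℝ} (H : ℝ) [Fact (1 < p)] (b σ : ℝ → ℝ → PathSpace T → ℝ)
    (ω : PathSpace T) (y : ℝ → ℝ × HpSpace T p) (s : ℝ) : ℝ × HpSpace T p :=
  (bTilde p H b σ s (y s).1 (ω + primitive (y s).2) +
    ∫ u in (0 : ℝ)..s, σ s (y s).1 (ω + primitive (y s).2) *
      partialX σ u (y u).1 (ω + primitive (y u).2) * phi H s u,
    partialX σ s (y s).1 (ω + primitive (y s).2) • phiH T p H s)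

section

variable {T : ℝ}

theorem tendsto_slope_of_hasDerivAt {f : ℝ → ℝ} {f' x : ℝ} (h : HasDerivAt f f' x) :
    Tendsto (fun n : ℕ => (1 / ((n : ℝ) + 1))⁻¹ * (f (x + 1 / ((n : ℝ) + 1)) - f x)) atTop
      (𝓝 f') := by
  refine h.tendsto_slope_zero.comp (tendsto_nhdsWithin_iff.2
    ⟨tendsto_one_div_add_atTop_nhds_zero_nat, Eventually.of_forall fun n => ?_⟩)
  have : (0 : ℝ) < 1 / ((n : ℝ) + 1) := by positivity
  exact this.ne'

theorem measurable_coefficient {F : ℝ → ℝ → PathSpace T → ℝ}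
    (hF : Measurable fun q : Icc (0 : ℝ) T × ℝ × PathSpace T => F q.1 q.2.1 q.2.2)
    {x : Icc (0 : ℝ) T → ℝ} {Γ : Icc (0 : ℝ) T → PathSpace T} (hx : Continuous x)
    (hΓ : Continuous Γ) : Measurable fun s : Icc (0 : ℝ) T => F s (x s) (Γ s) :=
  hF.comp (measurable_id.prodMk (hx.measurable.prodMk hΓ.measurable))

variable {p H L : ℝ} [Fact (1 < p)] {b σ : ℝ → ℝ → PathSpace T → ℝ}
  (hc : CoefficientHypothesis T p H L b σ)
include hc

/-- Along continuous paths `σ_x` is measurable, as a limit of difference quotients of `σ`. -/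
theorem CoefficientHypothesis.measurable_partialX {x : Icc (0 : ℝ) T → ℝ}
    {Γ : Icc (0 : ℝ) T → PathSpace T} (hx : Continuous x) (hΓ : Continuous Γ) :
    Measurable fun s : Icc (0 : ℝ) T => partialX σ s (x s) (Γ s) := by
  refine measurable_of_tendsto_metrizable (f := fun (n : ℕ) (s : Icc (0 : ℝ) T) =>
    (1 / ((n : ℝ) + 1))⁻¹ * (σ s (x s + 1 / ((n : ℝ) + 1)) (Γ s) - σ s (x s) (Γ s)))
    (fun n => ((measurable_coefficient hc.σ_measurable (hx.add continuous_const) hΓ).sub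
      (measurable_coefficient hc.σ_measurable hx hΓ)).const_mul _) ?_
  rw [tendsto_pi_nhds]
  intro s
  exact tendsto_slope_of_hasDerivAt (hc.σ_differentiableX s.2 (Γ s) (x s)).hasDerivAt

/-- Along continuous paths `𝔻^φ σ` is measurable, as a limit of difference quotients of `σ` in the
directions `∫₀^· φ(s, u) du`, which depend continuously on `s`. -/
theorem CoefficientHypothesis.measurable_dPhi (hH1 : H < 1) (hp : p < 1 / (2 - 2 * H))
    {x : Icc (0 : ℝ) T → ℝ} {Γ : Icc (0 : ℝ) T → PathSpace T} (hx : Continuous x)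
    (hΓ : Continuous Γ) :
    Measurable fun s : Icc (0 : ℝ) T => dPhi p H s (σ s (x s)) (Γ s) := by
  have hφ : Continuous fun s : Icc (0 : ℝ) T => primitive (phiH T p H s) :=
    continuous_primitive.comp (continuousOn_iff_continuous_domRestrict.1 (continuousOn_phiH hH1 hp))
  have hv : ∀ c : ℝ, Measurable fun s : Icc (0 : ℝ) T =>
      σ s (x s) (Γ s + c • primitive (phiH T p H s)) := fun c =>
    measurable_coefficient (Γ := fun s => Γ s + c • primitive (phiH T p H s)) hc.σ_measurable hx
      (hΓ.add (hφ.const_smul c))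
  refine measurable_of_tendsto_metrizable (f := fun (n : ℕ) (s : Icc (0 : ℝ) T) =>
    (1 / ((n : ℝ) + 1))⁻¹ *
      (σ s (x s) (Γ s + (0 + 1 / ((n : ℝ) + 1)) • primitive (phiH T p H s)) -
      σ s (x s) (Γ s + (0 : ℝ) • primitive (phiH T p H s))))
    (fun n => ((hv _).sub (hv _)).const_mul _) ?_
  rw [tendsto_pi_nhds]
  intro s
  exact tendsto_slope_of_hasDerivAt
    ((hc.σ_hDifferentiable s s.2 (x s)).hasHDerivAt (Γ s) (phiH T p H s))

variable (ω : PathSpace T) {y : ℝ → ℝ × HpSpace T p} (hy : ContinuousOn y (Icc 0 T))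
include hy

theorem CoefficientHypothesis.aestronglyMeasurable_partialX :
    AEStronglyMeasurable (fun s => partialX σ s (y s).1 (ω + primitive (y s).2))
      (volume.restrict (Icc 0 T)) := by
  have hy' := continuousOn_iff_continuous_domRestrict.1 hy
  exact (aemeasurable_restrict_of_measurable_subtype measurableSet_Icc
    (hc.measurable_partialX (continuous_fst.comp hy')
      (continuous_const.add (continuous_primitive.comp (continuous_snd.comp hy'))))
    ).aestronglyMeasurable

theorem CoefficientHypothesis.aestronglyMeasurable_bTilde (hH1 : H < 1)
    (hp : p < 1 / (2 - 2 * H)) :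
    AEStronglyMeasurable (fun s => bTilde p H b σ s (y s).1 (ω + primitive (y s).2))
      (volume.restrict (Icc 0 T)) := by
  have hy' := continuousOn_iff_continuous_domRestrict.1 hy
  have hx := continuous_fst.comp hy'
  have hΓ : Continuous fun s : Icc (0 : ℝ) T => ω + primitive (y s).2 :=
    continuous_const.add (continuous_primitive.comp (continuous_snd.comp hy'))
  exact (aemeasurable_restrict_of_measurable_subtype measurableSet_Icc
    ((measurable_coefficient hc.b_measurable hx hΓ).sub
      (hc.measurable_dPhi hH1 hp hx hΓ))).aestronglyMeasurable

theorem CoefficientHypothesis.aestronglyMeasurable_drift (hH1 : H < 1)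
    (hp : p < 1 / (2 - 2 * H)) :
    AEStronglyMeasurable (drift H b σ ω y) (volume.restrict (Icc 0 T)) := by
  have hy' := continuousOn_iff_continuous_domRestrict.1 hy
  have hx := continuous_fst.comp hy'
  have hΓ : Continuous fun s : Icc (0 : ℝ) T => ω + primitive (y s).2 :=
    continuous_const.add (continuous_primitive.comp (continuous_snd.comp hy'))
  have h1 := hc.aestronglyMeasurable_bTilde ω hy hH1 hp
  have h2 : AEStronglyMeasurable (fun s => σ s (y s).1 (ω + primitive (y s).2))
      (volume.restrict (Icc 0 T)) :=
    (aemeasurable_restrict_of_measurable_subtype measurableSet_Icc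
      (measurable_coefficient hc.σ_measurable hx hΓ)).aestronglyMeasurable
  have h3 := hc.aestronglyMeasurable_partialX ω hy
  have h4 := aestronglyMeasurable_integral_mul_phi T H h3
  refine (h1.add ((h2.mul h4).congr (Eventually.of_forall fun s => ?_))).prodMk
    (h3.smul ((continuousOn_phiH hH1 hp).aestronglyMeasurable measurableSet_Icc))
  simp only [mul_assoc, intervalIntegral.integral_const_mul, Pi.mul_apply]

theorem CoefficientHypothesis.intervalIntegrable_bTilde (hH1 : H < 1)
    (hp : p < 1 / (2 - 2 * H)) (hT : 0 ≤ T) (hL : 0 ≤ L) :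
    IntervalIntegrable (fun s => bTilde p H b σ s (y s).1 (ω + primitive (y s).2)) volume 0 T := by
  obtain ⟨M, hM⟩ := isCompact_Icc.exists_bound_of_continuousOn hy
  rw [intervalIntegrable_iff_integrableOn_Icc_of_le hT]
  refine Integrable.of_bound (hc.aestronglyMeasurable_bTilde ω hy hH1 hp) (2 * (L * (1 + M))) ?_
  filter_upwards [ae_restrict_mem measurableSet_Icc] with s hs
  have e1 := hc.b_growth s hs (y s).1 (ω + primitive (y s).2)
  have e2 := hc.σ_dPhi s hs (y s).1 (ω + primitive (y s).2)
  have e3 := abs_sub (b s (y s).1 (ω + primitive (y s).2))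
    (dPhi p H s (σ s (y s).1) (ω + primitive (y s).2))
  have e4 : |(y s).1| ≤ M := (norm_fst_le (y s)).trans (hM s hs)
  have e5 : L * (1 + |(y s).1|) ≤ L * (1 + M) := mul_le_mul_of_nonneg_left (by linarith) hL
  rw [Real.norm_eq_abs, bTilde]
  linarith

end

section

variable {T p H L C : ℝ} [Fact (1 < p)] {b σ : ℝ → ℝ → PathSpace T → ℝ}

/-- The coefficients of the characteristic system satisfy the assumptions on Young–Volterra
equations in the state space `ℝ × ℋ_p`. -/
theorem CoefficientHypothesis.youngVolterra (hc : CoefficientHypothesis T p H L b σ)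
    (hH : 1 / 2 < H) (hH1 : H < 1) (hp : p < 1 / (2 - 2 * H)) (hT : 0 ≤ T) (hL : 0 ≤ L)
    (hC0 : 0 ≤ C)
    (hC : ∀ s ∈ Icc 0 T, ‖phiH T p H s‖ ≤ C ∧ ∫ u in (0 : ℝ)..s, phi H s u ≤ C)
    (ω : PathSpace T) :
    YoungVolterra T (4 * (L + L * C + L * (L * C))) (diffusion σ ω) (drift (p := p) H b σ ω) := by
  set K := 4 * (L + L * C + L * (L * C)) with hK
  have hLC : 0 ≤ L * C := by positivity
  have hLLC : 0 ≤ L * (L * C) := by positivity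
  have n1 : ∀ y : ℝ × HpSpace T p, |y.1| ≤ ‖y‖ := fun y => norm_fst_le y
  have n2 : ∀ y : ℝ × HpSpace T p, ‖y.2‖ ≤ ‖y‖ := fun y => norm_snd_le y
  have hshift : ∀ G G' : HpSpace T p,
      ω + primitive G = ω + primitive G' + primitive (G - G') := fun G G' => by
    rw [primitive_sub]; abel
  have hsum : ∀ x y : ℝ × HpSpace T p, L * (|x.1 - y.1| + ‖x.2 - y.2‖) ≤ 2 * L * ‖x - y‖ :=
    fun x y => by
      have h1 := n1 (x - y)
      have h2 := n2 (x - y)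
      rw [Prod.fst_sub] at h1
      rw [Prod.snd_sub] at h2
      have := mul_le_mul_of_nonneg_left (add_le_add h1 h2) hL
      linarith
  -- Lipschitz bounds in the state space
  have σ_lip : ∀ t ∈ Icc 0 T, ∀ x y : ℝ × HpSpace T p,
      |σ t x.1 (ω + primitive x.2) - σ t y.1 (ω + primitive y.2)| ≤ 2 * L * ‖x - y‖ :=
    fun t ht x y => by
      rw [hshift x.2 y.2]
      exact (hc.σ_sub_le ht _ _ _ _).trans (hsum x y)
  have b_lip : ∀ t ∈ Icc 0 T, ∀ x y : ℝ × HpSpace T p,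
      |b t x.1 (ω + primitive x.2) - b t y.1 (ω + primitive y.2)| ≤ 2 * L * ‖x - y‖ :=
    fun t ht x y => by
      rw [hshift x.2 y.2]
      exact (hc.b_sub_le ht _ _ _ _).trans (hsum x y)
  have k_lip : ∀ t ∈ Icc 0 T, ∀ x y : ℝ × HpSpace T p,
      |partialX σ t x.1 (ω + primitive x.2) - partialX σ t y.1 (ω + primitive y.2)| ≤
        2 * L * ‖x - y‖ := fun t ht x y => by
      rw [hshift x.2 y.2]
      exact (hc.partialX_sub_le ht _ _ _ _).trans (hsum x y)
  have d_lip : ∀ t ∈ Icc 0 T, ∀ x y : ℝ × HpSpace T p,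
      |dPhi p H t (σ t x.1) (ω + primitive x.2) - dPhi p H t (σ t y.1) (ω + primitive y.2)| ≤
        2 * (L * C) * ‖x - y‖ := fun t ht x y => by
      rw [hshift x.2 y.2]
      refine (hc.dPhi_sub_le ht hL _ _ _ _).trans ?_
      calc _ ≤ 2 * L * ‖x - y‖ * C :=
            mul_le_mul (hsum x y) (hC t ht).1 (norm_nonneg _) (by positivity)
        _ = _ := by ring
  have U_growth : ∀ y : ℝ → ℝ × HpSpace T p, ∀ s ∈ Icc 0 T, ∀ M, (∀ u ∈ Icc 0 s, ‖y u‖ ≤ M) →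
      ‖drift H b σ ω y s‖ ≤ K * (1 + M) := by
    intro y s hs M hM
    have hy := hM s ⟨hs.1, le_rfl⟩
    have hM0 : 0 ≤ M := (norm_nonneg _).trans hy
    have hg : ∀ c, 0 ≤ c → c * (1 + |(y s).1|) ≤ c * (1 + M) := fun c hc =>
      mul_le_mul_of_nonneg_left (by linarith [n1 (y s)]) hc
    have e1 := (hc.b_growth s hs (y s).1 (ω + primitive (y s).2)).trans (hg L hL)
    have e2 := (hc.σ_dPhi s hs (y s).1 (ω + primitive (y s).2)).trans (hg L hL)
    have e3 := (hc.σ_growth s hs (y s).1 (ω + primitive (y s).2)).trans (hg L hL)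
    have e4 := abs_integral_mul_phi_le (p := p) hH hH1 hp hs (hC s hs).2 hL
      (w := fun u => partialX σ u (y u).1 (ω + primitive (y u).2))
      fun u hu => hc.abs_partialX_le ⟨hu.1, hu.2.trans hs.2⟩ _ _
    have hK1 : K * (1 + M) = 4 * (L * (1 + M)) + 4 * (L * C * (1 + M)) +
        4 * (L * (1 + M) * (L * C)) := by rw [hK]; ring
    have p1 : 0 ≤ L * (1 + M) := by positivity
    have p2 : 0 ≤ L * C * (1 + M) := by positivity
    have p3 : 0 ≤ L * (1 + M) * (L * C) := by positivity
    refine norm_prod_le_iff.2 ⟨?_, ?_⟩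
    · simp only [drift, bTilde, mul_assoc, intervalIntegral.integral_const_mul, Real.norm_eq_abs]
      refine (abs_add_le _ _).trans ?_
      rw [abs_mul]
      have e5 := mul_le_mul e3 e4 (abs_nonneg _) p1
      have e6 := abs_sub (b s (y s).1 (ω + primitive (y s).2))
        (dPhi p H s (σ s (y s).1) (ω + primitive (y s).2))
      linarith
    · simp only [drift, norm_smul, Real.norm_eq_abs]
      have e5 := mul_le_mul (hc.abs_partialX_le hs (y s).1 (ω + primitive (y s).2)) (hC s hs).1
        (norm_nonneg _) hL
      have e6 : L * C ≤ L * C * (1 + M) := le_mul_of_one_le_right hLC (by linarith)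
      linarith
  refine ⟨?_, ?_, ?_, ?_, ?_, fun y _ => U_growth y, ?_, ?_⟩
  · intro t ht y
    have h1 := hc.σ_growth t ht y.1 (ω + primitive y.2)
    have h2 : L * (1 + |y.1|) ≤ K * (1 + ‖y‖) :=
      mul_le_mul (by linarith) (by linarith [n1 y]) (by positivity) (by linarith)
    exact h1.trans h2
  · intro t ht x y
    exact (σ_lip t ht x y).trans (mul_le_mul_of_nonneg_right (by linarith) (norm_nonneg _))
  · intro s hs t ht y
    have h1 := hc.σ_time_le ht hs y.1 (ω + primitive y.2)
    have h2 : L * (1 + |y.1|) ≤ K * (1 + ‖y‖) :=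
      mul_le_mul (by linarith) (by linarith [n1 y]) (by positivity) (by linarith)
    exact h1.trans (mul_le_mul_of_nonneg_right h2 (abs_nonneg _))
  · intro t ht y h k
    simp only [diffusion, Prod.fst_add, Prod.snd_add, primitive_add, ← add_assoc]
    set ν := ω + primitive y.2
    -- the increments in the directions `h` and `k` split into those in `x` and those in `ℋ_p`
    have e1 := hc.σ_rect_xx ht (y.1 + k.1) y.1 h.1 (ν + primitive h.2 + primitive k.2)
    have e2 := hc.σ_rect_xh ht (y.1 + h.1) y.1 (ν + primitive h.2) k.2
    have e3 := hc.σ_rect_xh ht (y.1 + k.1) y.1 (ν + primitive k.2) h.2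
    have e4 := hc.σ_rect_hh ht y.1 ν h.2 k.2
    rw [add_sub_cancel_left] at e1 e2 e3
    rw [add_right_comm ν (primitive k.2) (primitive h.2)] at e3
    rw [add_right_comm y.1 k.1 h.1] at e1
    have m1 := mul_le_mul_of_nonneg_left
      (mul_le_mul (n1 h) (n1 k) (abs_nonneg _) (norm_nonneg _)) hL
    have m2 := mul_le_mul_of_nonneg_left
      (mul_le_mul (n2 k) (n1 h) (abs_nonneg _) (norm_nonneg _)) hL
    have m3 := mul_le_mul_of_nonneg_left
      (mul_le_mul (n2 h) (n1 k) (abs_nonneg _) (norm_nonneg _)) hL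
    have m4 := mul_le_mul_of_nonneg_left
      (mul_le_mul (n2 k) (n2 h) (norm_nonneg _) (norm_nonneg _)) hL
    have m5 : 4 * (L * (‖h‖ * ‖k‖)) ≤ K * (‖h‖ * ‖k‖) := by
      rw [← mul_assoc]
      exact mul_le_mul_of_nonneg_right (by linarith) (by positivity)
    rw [mul_comm ‖k‖ ‖h‖] at m2 m4
    rw [abs_le] at *
    constructor <;> linarith [e1.1, e1.2, e2.1, e2.2, e3.1, e3.2, e4.1, e4.2]
  · intro s hs t ht x y
    simp only [diffusion]
    rw [hshift x.2 y.2]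
    refine (hc.σ_time_sub_le ht hs x.1 y.1 (ω + primitive y.2) (x.2 - y.2)).trans ?_
    calc _ ≤ 2 * L * ‖x - y‖ * |t - s| := mul_le_mul_of_nonneg_right (hsum x y) (abs_nonneg _)
      _ = 2 * L * (|t - s| * ‖x - y‖) := by ring
      _ ≤ _ := mul_le_mul_of_nonneg_right (by linarith) (by positivity)
  · intro x y hx hy s hs R d hxR hyR hd
    have hss : s ∈ Icc 0 s := ⟨hs.1, le_rfl⟩
    have hR0 : 0 ≤ R := (norm_nonneg _).trans (hxR s hss)
    have hd0 : 0 ≤ d := (norm_nonneg _).trans (hd s hss)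
    have hds := hd s hss
    have lip : ∀ c, 0 ≤ c → 2 * c * ‖x s - y s‖ ≤ 2 * c * d := fun c hc =>
      mul_le_mul_of_nonneg_left hds (by positivity)
    have e1 := (b_lip s hs (x s) (y s)).trans (lip L hL)
    have e2 := (d_lip s hs (x s) (y s)).trans (lip (L * C) hLC)
    have e3 := (σ_lip s hs (x s) (y s)).trans (lip L hL)
    have e4 := (k_lip s hs (x s) (y s)).trans (lip L hL)
    have e5 : |σ s (y s).1 (ω + primitive (y s).2)| ≤ L * (1 + R) :=
      (hc.σ_growth s hs (y s).1 (ω + primitive (y s).2)).trans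
        (mul_le_mul_of_nonneg_left (by linarith [n1 (y s), hyR s hss]) hL)
    have hkb : ∀ y : ℝ → ℝ × HpSpace T p, ∀ u ∈ Icc 0 s,
        |partialX σ u (y u).1 (ω + primitive (y u).2)| ≤ L := fun y u hu =>
      hc.abs_partialX_le ⟨hu.1, hu.2.trans hs.2⟩ _ _
    have e6 := abs_integral_mul_phi_le (p := p) hH hH1 hp hs (hC s hs).2 hL (hkb x)
    have e7 := abs_integral_mul_phi_le (p := p) hH hH1 hp hs (hC s hs).2
      (w := fun u => partialX σ u (x u).1 (ω + primitive (x u).2) -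
        partialX σ u (y u).1 (ω + primitive (y u).2)) (m := 2 * L * d) (by positivity)
      fun u hu => (k_lip u ⟨hu.1, hu.2.trans hs.2⟩ (x u) (y u)).trans
        (mul_le_mul_of_nonneg_left (hd u hu) (by positivity))
    simp only [sub_mul] at e7
    rw [intervalIntegral.integral_sub
      (intervalIntegrable_mul_phi (p := p) hH1 hp hs
        (hc.aestronglyMeasurable_partialX ω hx) (hkb x))
      (intervalIntegrable_mul_phi (p := p) hH1 hp hs
        (hc.aestronglyMeasurable_partialX ω hy) (hkb y))] at e7
    have hK1 : K * (1 + R) * d = 4 * (L * d) + 4 * (L * C * d) + 4 * (L * d * (L * C)) +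
        R * (4 * (L * d) + 4 * (L * C * d)) + 4 * (R * (L * d * (L * C))) := by rw [hK]; ring
    have p1 : 0 ≤ L * d := by positivity
    have p2 : 0 ≤ L * C * d := by positivity
    have p3 : 0 ≤ L * d * (L * C) := by positivity
    have p4 : 0 ≤ R * (4 * (L * d) + 4 * (L * C * d)) := by positivity
    have p5 : 0 ≤ R * (L * d * (L * C)) := by positivity
    refine norm_prod_le_iff.2 ⟨?_, ?_⟩
    · simp only [drift, bTilde, mul_assoc, intervalIntegral.integral_const_mul, Real.norm_eq_abs,
        Prod.fst_sub]
      set V := ∫ u in (0 : ℝ)..s, partialX σ u (x u).1 (ω + primitive (x u).2) * phi H s u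
      set V' := ∫ u in (0 : ℝ)..s, partialX σ u (y u).1 (ω + primitive (y u).2) * phi H s u
      have q1 : |σ s (x s).1 (ω + primitive (x s).2) * V -
          σ s (y s).1 (ω + primitive (y s).2) * V'| ≤
          2 * L * d * (L * C) + L * (1 + R) * (2 * L * d * C) := by
        rw [show σ s (x s).1 (ω + primitive (x s).2) * V -
          σ s (y s).1 (ω + primitive (y s).2) * V' =
          (σ s (x s).1 (ω + primitive (x s).2) - σ s (y s).1 (ω + primitive (y s).2)) * V +
          σ s (y s).1 (ω + primitive (y s).2) * (V - V') by ring]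
        refine (abs_add_le _ _).trans (add_le_add ?_ ?_)
        · rw [abs_mul]; exact mul_le_mul e3 e6 (abs_nonneg _) (by positivity)
        · rw [abs_mul]; exact mul_le_mul e5 e7 (abs_nonneg _) (by positivity)
      have q2 : 2 * L * d * (L * C) + L * (1 + R) * (2 * L * d * C) =
        4 * (L * d * (L * C)) + 2 * (R * (L * d * (L * C))) := by ring
      rw [q2] at q1
      rw [abs_le] at *
      constructor <;> linarith [e1.1, e1.2, e2.1, e2.2, q1.1, q1.2]
    · simp only [drift, Prod.snd_sub]
      rw [← sub_smul, norm_smul, Real.norm_eq_abs]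
      have e8 := mul_le_mul e4 (hC s hs).1 (norm_nonneg _) (by positivity)
      linarith
  · intro y hy
    obtain ⟨M, hM⟩ := isCompact_Icc.exists_bound_of_continuousOn hy
    rw [intervalIntegrable_iff_integrableOn_Icc_of_le hT]
    refine Integrable.of_bound (hc.aestronglyMeasurable_drift ω hy hH1 hp) (K * (1 + M)) ?_
    filter_upwards [ae_restrict_mem measurableSet_Icc] with s hs
    exact U_growth y s hs M fun u hu => hM u ⟨hu.1, hu.2.trans hs.2⟩

end

/-! ### Existence, uniqueness and bounds -/

theorem abs_sub_le_of_holderSeminorm {β a b : ℝ} {f : ℝ → ℝ} (h : holderSeminorm β f a b < ∞)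
    (s t : ℝ) (hs : a ≤ s) (hst : s ≤ t) (ht : t ≤ b) :
    |f t - f s| ≤ (holderSeminorm β f a b).toReal * (t - s) ^ β := by
  rcases hst.eq_or_lt with rfl | hlt
  · rw [sub_self, abs_zero]
    exact mul_nonneg ENNReal.toReal_nonneg (Real.rpow_nonneg (by simp) _)
  have hpos : 0 < (t - s) ^ β := Real.rpow_pos_of_pos (sub_pos.2 hlt) _
  rw [← div_le_iff₀ hpos]
  have h1 : ENNReal.ofReal (|f t - f s| / |t - s| ^ β) ≤ holderSeminorm β f a b :=
    le_iSup₂_of_le s t (le_iSup_of_le ⟨hs, hlt, ht⟩ le_rfl)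
  rw [abs_of_pos (sub_pos.2 hlt)] at h1
  exact (ENNReal.ofReal_le_iff_le_toReal h.ne).1 h1

theorem holderSeminorm_le {β a b C : ℝ} {f : ℝ → ℝ}
    (h : ∀ s t, a ≤ s → s < t → t ≤ b → |f t - f s| ≤ C * (t - s) ^ β) :
    holderSeminorm β f a b ≤ ENNReal.ofReal C := by
  refine iSup₂_le fun s t => iSup_le fun hst => ENNReal.ofReal_le_ofReal ?_
  have hpos : 0 < t - s := sub_pos.2 hst.2.1
  rw [abs_of_pos hpos, div_le_iff₀ (Real.rpow_pos_of_pos hpos _)]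
  exact h s t hst.1 hst.2.1 hst.2.2

/-- The pathwise integral up to time `t` depends only on the integrand on `[0, t]`. -/
theorem IsPathwiseIntegral.congr {f f' g : ℝ → ℝ} {t I : ℝ} (h : IsPathwiseIntegral f g t I)
    (hf : ∀ s ∈ Icc 0 t, f s = f' s) : IsPathwiseIntegral f' g t I := by
  intro ε hε
  obtain ⟨δ, hδ, H⟩ := h ε hε
  refine ⟨δ, hδ, fun n s h0 hn hs => ?_⟩
  have hlow : ∀ i ≤ n, 0 ≤ s i := fun i hi => by
    induction i with
    | zero => exact h0.ge
    | succ i ih => exact (ih (by omega)).trans (hs i (by omega)).1.le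
  have hup : ∀ j ≤ n, s (n - j) ≤ t := fun j hj => by
    induction j with
    | zero => exact hn.le
    | succ j ih =>
      have h1 := (hs (n - (j + 1)) (by omega)).1.le
      rw [show n - (j + 1) + 1 = n - j by omega] at h1
      exact h1.trans (ih (by omega))
  have e := H n s h0 hn hs
  have hsum : ∑ i ∈ Finset.range n, f (s i) * (g (s (i + 1)) - g (s i)) =
      ∑ i ∈ Finset.range n, f' (s i) * (g (s (i + 1)) - g (s i)) := by
    refine Finset.sum_congr rfl fun i hi => ?_
    have hi' := Finset.mem_range.1 hi
    have h2 := hup (n - i) (by omega)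
    rw [Nat.sub_sub_self hi'.le] at h2
    rw [hf (s i) ⟨hlow i hi'.le, h2⟩]
  rwa [hsum] at e

theorem IsHolder.prodMk {E F : Type*} [NormedAddCommGroup E] [NormedAddCommGroup F] {α T : ℝ}
    {x : ℝ → E} {y : ℝ → F} (hx : IsHolder α T x) (hy : IsHolder α T y) :
    IsHolder α T fun t => (x t, y t) := by
  obtain ⟨M, hM⟩ := hx
  obtain ⟨N, hN⟩ := hy
  refine ⟨max M N, fun s t hs hst ht => ?_⟩
  have hp : 0 ≤ (t - s) ^ α := Real.rpow_nonneg (by linarith) _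
  rw [Prod.mk_sub_mk]
  exact norm_prod_le_iff.2
    ⟨(hM s t hs hst ht).trans (mul_le_mul_of_nonneg_right (le_max_left _ _) hp),
      (hN s t hs hst ht).trans (mul_le_mul_of_nonneg_right (le_max_right _ _) hp)⟩

section

variable {T p H L C : ℝ} [Fact (1 < p)] {b σ : ℝ → ℝ → PathSpace T → ℝ}

/-- The components of the integral of the drift, together with the integrability of the three
integrands of the characteristic system. -/
theorem CoefficientHypothesis.integral_drift (hc : CoefficientHypothesis T p H L b σ)
    (hH1 : H < 1) (hp : p < 1 / (2 - 2 * H)) (hT : 0 ≤ T) (hL : 0 ≤ L) (ω : PathSpace T)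
    {y : ℝ → ℝ × HpSpace T p} (hy : ContinuousOn y (Icc 0 T))
    (hU : IntervalIntegrable (drift H b σ ω y) volume 0 T) :
    IntervalIntegrable (fun s => partialX σ s (y s).1 (ω + primitive (y s).2) • phiH T p H s)
      volume 0 T ∧
    IntervalIntegrable (fun s => ∫ u in (0 : ℝ)..s, σ s (y s).1 (ω + primitive (y s).2) *
      partialX σ u (y u).1 (ω + primitive (y u).2) * phi H s u) volume 0 T ∧
    ∀ t ∈ Icc 0 T, ∫ s in (0 : ℝ)..t, drift H b σ ω y s =
      ((∫ s in (0 : ℝ)..t, bTilde p H b σ s (y s).1 (ω + primitive (y s).2)) +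
        (∫ s in (0 : ℝ)..t, ∫ u in (0 : ℝ)..s, σ s (y s).1 (ω + primitive (y s).2) *
          partialX σ u (y u).1 (ω + primitive (y u).2) * phi H s u),
        ∫ s in (0 : ℝ)..t, partialX σ s (y s).1 (ω + primitive (y s).2) • phiH T p H s) := by
  have hb := hc.intervalIntegrable_bTilde ω hy hH1 hp hT hL
  have h1 : IntervalIntegrable (fun s => (drift H b σ ω y s).1) volume 0 T :=
    ⟨hU.1.fst, hU.2.fst⟩
  have h2 : IntervalIntegrable (fun s => (drift H b σ ω y s).2) volume 0 T :=
    ⟨hU.1.snd, hU.2.snd⟩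
  have h3 : IntervalIntegrable (fun s => ∫ u in (0 : ℝ)..s, σ s (y s).1 (ω + primitive (y s).2) *
      partialX σ u (y u).1 (ω + primitive (y u).2) * phi H s u) volume 0 T := by
    refine (h1.sub hb).congr fun s _ => ?_
    simp only [drift, add_sub_cancel_left]
  refine ⟨h2, h3, fun t ht => ?_⟩
  have hsub : uIcc 0 t ⊆ uIcc 0 T := by
    rw [uIcc_of_le ht.1, uIcc_of_le hT]; exact Icc_subset_Icc_right ht.2
  rw [← intervalIntegral.integral_add (hb.mono_set hsub) (h3.mono_set hsub)]
  refine Prod.ext ?_ ?_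
  · exact ((ContinuousLinearMap.fst ℝ ℝ (HpSpace T p)).intervalIntegral_comp_comm
      (hU.mono_set hsub)).symm
  · exact ((ContinuousLinearMap.snd ℝ ℝ (HpSpace T p)).intervalIntegral_comp_comm
      (hU.mono_set hsub)).symm

/-- A Hölder fixed point of the Picard map in the state space gives a solution of the
characteristic system. -/
theorem CoefficientHypothesis.isCharacteristicSolution (hc : CoefficientHypothesis T p H L b σ)
    (hH1 : H < 1) (hp : p < 1 / (2 - 2 * H)) (hT : 0 ≤ T) (hL : 0 ≤ L) {β K : ℝ}
    (hβ : 1 / 2 < β) (η : PathSpace T → ℝ) (ω : PathSpace T)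
    (hf : YoungVolterra T K (diffusion σ ω) (drift (p := p) H b σ ω))
    {y : ℝ → ℝ × HpSpace T p} (hy : IsHolder β T y)
    (hyP : IsPicardImage (β + β) T (diffusion σ ω) (drift H b σ ω) (coord ω) (1, 0) (η ω, 0) y y) :
    IsCharacteristicSolution p H β b σ η ω (fun t => ω + primitive (y t).2) fun t => (y t).1 := by
  have hyc := hy.continuousOn (by linarith : 0 < β)
  obtain ⟨i1, i2, hint⟩ := hc.integral_drift hH1 hp hT hL ω hyc (hf.U_integrable y hyc)
  obtain ⟨J, hJ0, hJ, hyJ⟩ := hyP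
  refine ⟨⟨fun t => (y t).2, continuous_snd.comp_continuousOn hyc, fun t _ => rfl⟩,
    ⟨β, by linarith, ?_⟩, i1, fun t ht => ?_,
    hc.intervalIntegrable_bTilde ω hyc hH1 hp hT hL, fun s hs => ?_, i2, fun t ht => ?_⟩
  · obtain ⟨M, hM⟩ := hy
    refine (holderSeminorm_le (C := M) fun s t hs hst ht => ?_).trans_lt ENNReal.ofReal_lt_top
    exact (norm_fst_le (y t - y s)).trans (hM s t hs hst.le ht)
  · have e := congrArg Prod.snd (hyJ t ht)
    rw [hint t ht] at e
    simp only [Prod.snd_add, Prod.smul_snd, smul_zero, add_zero, zero_add] at e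
    rw [← e]
  · simp only [mul_assoc]
    exact (intervalIntegrable_mul_phi (p := p) hH1 hp hs
      (hc.aestronglyMeasurable_partialX ω hyc) fun u hu =>
        hc.abs_partialX_le ⟨hu.1, hu.2.trans hs.2⟩ _ _).const_mul _
  · have hI := hJ.isPathwiseIntegral (by linarith) ht
    rw [hJ0, sub_zero] at hI
    refine ⟨J t, hI, ?_⟩
    have e := congrArg Prod.fst (hyJ t ht)
    rw [hint t ht] at e
    simp only [Prod.fst_add, Prod.smul_fst, smul_eq_mul, mul_one] at e
    rw [e]
    ring

/-- Conversely, the state `(z, ∫₀^· σ_x φ(s, ·) ds)` of a solution of the characteristic system is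
a Hölder fixed point of the Picard map. -/
theorem CoefficientHypothesis.isPicardImage (hc : CoefficientHypothesis T p H L b σ)
    (hH1 : H < 1) (hp : p < 1 / (2 - 2 * H)) (hT : 0 ≤ T) (hL : 0 ≤ L)
    (hC : ∀ s ∈ Icc 0 T, ‖phiH T p H s‖ ≤ C) {α β μ K : ℝ} (hα : 0 < α) (hα1 : α ≤ 1)
    (hαμ : α ≤ μ) (hβ : 0 ≤ β) (hθ : 1 < α + β) (hK : 0 ≤ K) {η : PathSpace T → ℝ}
    {ω : PathSpace T} (hω : holderSeminorm β (coord ω) 0 T < ∞)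
    (hf : YoungVolterra T K (diffusion σ ω) (drift (p := p) H b σ ω))
    {Γ : ℝ → PathSpace T} {z : ℝ → ℝ} (hz : IsCharacteristicSolution p H β b σ η ω Γ z)
    (hμ : holderSeminorm μ z 0 T < ∞) {y : ℝ → ℝ × HpSpace T p}
    (hy : y = fun t => (z t, ∫ s in (0 : ℝ)..t, partialX σ s (z s) (Γ s) • phiH T p H s)) :
    IsHolder α T y ∧
      IsPicardImage (α + β) T (diffusion σ ω) (drift H b σ ω) (coord ω) (1, 0) (η ω, 0) y y := by
  have hsub : ∀ t ∈ Icc 0 T, uIcc 0 t ⊆ uIcc 0 T := fun t ht => by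
    rw [uIcc_of_le ht.1, uIcc_of_le hT]; exact Icc_subset_Icc_right ht.2
  have hyH : IsHolder α T y := by
    rw [hy]
    refine IsHolder.prodMk (IsHolder.mono hα hαμ ⟨_, abs_sub_le_of_holderSeminorm hμ⟩)
      (IsHolder.mono hα hα1 ⟨L * C, fun s t hs hst ht => ?_⟩)
    rw [intervalIntegral.integral_interval_sub_left
      (hz.integrable_Γ.mono_set (hsub t ⟨hs.trans hst, ht⟩))
      (hz.integrable_Γ.mono_set (hsub s ⟨hs, hst.trans ht⟩)), Real.rpow_one]
    refine (intervalIntegral.norm_integral_le_of_norm_le_const (C := L * C)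
      fun r hr => ?_).trans (by rw [abs_of_nonneg (by linarith)])
    rw [uIoc_of_le hst] at hr
    have hrT : r ∈ Icc 0 T := ⟨hs.trans hr.1.le, hr.2.trans ht⟩
    rw [norm_smul]
    exact mul_le_mul (hc.abs_partialX_le hrT _ _) (hC r hrT) (norm_nonneg _) hL
  have hΓ : ∀ t ∈ Icc 0 T, ω + primitive (y t).2 = Γ t := fun t ht => by
    rw [hz.eq_Γ t ht, hy]
  have hy1 : ∀ t, (y t).1 = z t := fun t => by rw [hy]
  have hyc := hyH.continuousOn hα
  obtain ⟨-, -, hint⟩ := hc.integral_drift hH1 hp hT hL ω hyc (hf.U_integrable y hyc)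
  obtain ⟨J, hJ0, hJ⟩ := hf.exists_young hK hT hα hα1 hβ hθ ENNReal.toReal_nonneg
    (abs_sub_le_of_holderSeminorm hω) hyH
  refine ⟨hyH, J, hJ0, hJ, fun t ht => ?_⟩
  have hut : ∀ s ∈ uIcc 0 t, s ∈ Icc 0 T := fun s hs => by
    have := hsub t ht hs
    rwa [uIcc_of_le hT] at this
  obtain ⟨I, hI, hzt⟩ := hz.eq_z t ht
  have hIJ : I = J t := by
    refine IsPathwiseIntegral.unique ht.1 (hI.congr (f' := fun s => diffusion σ ω s (y s))
      fun s hs => ?_) (by simpa [hJ0] using hJ.isPathwiseIntegral hθ ht)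
    rw [diffusion, hΓ s ⟨hs.1, hs.2.trans ht.2⟩, hy1]
  rw [hint t ht]
  refine Prod.ext ?_ ?_
  · simp only [Prod.fst_add, Prod.smul_fst, smul_eq_mul, mul_one, hy1]
    rw [hzt, hIJ, intervalIntegral.integral_congr
        (f := fun s => bTilde p H b σ s (z s) (ω + primitive (y s).2))
        (g := fun s => bTilde p H b σ s (z s) (Γ s)) fun s hs => by simp only [hΓ s (hut s hs)],
      intervalIntegral.integral_congr (f := fun s => ∫ u in (0 : ℝ)..s,
        σ s (z s) (ω + primitive (y s).2) * partialX σ u (z u) (ω + primitive (y u).2) * phi H s u)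
        (g := fun s => ∫ u in (0 : ℝ)..s, σ s (z s) (Γ s) * partialX σ u (z u) (Γ u) * phi H s u)
        fun s hs => by
          have hsT := hut s hs
          refine intervalIntegral.integral_congr fun u hu => ?_
          have huT : u ∈ Icc 0 T := by
            rw [uIcc_of_le hsT.1] at hu
            exact ⟨hu.1, hu.2.trans hsT.2⟩
          simp only [hΓ s hsT, hΓ u huT]]
    ring
  · simp only [Prod.snd_add, Prod.smul_snd, smul_zero, add_zero, zero_add, hy1]
    rw [intervalIntegral.integral_congr
        (f := fun s => partialX σ s (z s) (ω + primitive (y s).2) • phiH T p H s)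
        (g := fun s => partialX σ s (z s) (Γ s) • phiH T p H s) fun s hs => by
          simp only [hΓ s (hut s hs)]]
    rw [hy]

/-- Two solutions agree on `[0, T]`. Their Hölder orders may differ; they are compared in the order
`α ≤ β` which both have, still greater than `1 - β`. -/
theorem CoefficientHypothesis.characteristicSolution_unique
    (hc : CoefficientHypothesis T p H L b σ) (hH1 : H < 1) (hp : p < 1 / (2 - 2 * H))
    (hT : 0 ≤ T) (hL : 0 ≤ L) (hC : ∀ s ∈ Icc 0 T, ‖phiH T p H s‖ ≤ C) {β K : ℝ}
    (hβ : 1 / 2 < β) (hβ1 : β < 1) (hK : 0 ≤ K) {η : PathSpace T → ℝ}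
    {ω : PathSpace T} (hω : holderSeminorm β (coord ω) 0 T < ∞)
    (hf : YoungVolterra T K (diffusion σ ω) (drift (p := p) H b σ ω))
    {Γ Γ' : ℝ → PathSpace T} {z z' : ℝ → ℝ} (h : IsCharacteristicSolution p H β b σ η ω Γ z)
    (h' : IsCharacteristicSolution p H β b σ η ω Γ' z') (t : ℝ) (ht : t ∈ Icc 0 T) :
    Γ' t = Γ t ∧ z' t = z t := by
  obtain ⟨μ, hμ, hzμ⟩ := h.holder
  obtain ⟨μ', hμ', hzμ'⟩ := h'.holder
  set α := min β (min μ μ')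
  have hαβ : α ≤ β := min_le_left _ _
  have hα : 1 - β < α := lt_min (by linarith) (lt_min hμ hμ')
  have hα0 : 0 < α := by linarith
  obtain ⟨a1, a2⟩ := hc.isPicardImage hH1 hp hT hL hC hα0 (hαβ.trans hβ1.le)
    ((min_le_right _ _).trans (min_le_left _ _)) (by linarith) (by linarith) hK hω hf h hzμ rfl
  obtain ⟨b1, b2⟩ := hc.isPicardImage hH1 hp hT hL hC hα0 (hαβ.trans hβ1.le)
    ((min_le_right _ _).trans (min_le_right _ _)) (by linarith) (by linarith) hK hω hf h' hzμ' rfl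
  have e := hf.unique hK hT hα0 hαβ hβ1.le (by linarith) ENNReal.toReal_nonneg
    (abs_sub_le_of_holderSeminorm hω) (by simp [Prod.norm_def]) b1 a1 b2 a2 t ht
  have e1 := congrArg Prod.fst e
  have e2 := congrArg Prod.snd e
  simp only at e1 e2
  exact ⟨by rw [h.eq_Γ t ht, h'.eq_Γ t ht, e2], e1⟩

end

/-- The scale `1 / (A (1 + Λ ^ (1 / β)))` is admissible for the invariant ball, for a constant `A`
which does not depend on the driving path. -/
theorem scale_small {β K S A Λ : ℝ} (hβ : 0 < β) (hK : 0 ≤ K) (hS : 0 ≤ S) (hΛ : 0 ≤ Λ)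
    (hA : A = 16 * K + (16 * (K * (1 + 2 * S))) ^ (1 / β) + 1) :
    K * (1 / (A * (1 + Λ ^ (1 / β)))) +
      K * (Λ * (1 / (A * (1 + Λ ^ (1 / β)))) ^ β) * (1 + 2 * S) ≤ 1 / 8 := by
  set X := Λ ^ (1 / β)
  have hX : 0 ≤ X := Real.rpow_nonneg hΛ _
  set B := 16 * (K * (1 + 2 * S)) with hB
  have hB0 : 0 ≤ B := by positivity
  have hB1 : 0 ≤ B ^ (1 / β) := Real.rpow_nonneg hB0 _
  have hA1 : 1 ≤ A := by linarith
  have hA0 : 0 < A := by linarith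
  set h := 1 / (A * (1 + X)) with hh
  have hh0 : 0 < h := by positivity
  have hAX : h * A + X * h * A = 1 := by rw [hh]; field_simp
  have hXh : 0 ≤ X * h := by positivity
  have e1 : K * h ≤ 1 / 16 := by
    have : 16 * K * h ≤ A * h := mul_le_mul_of_nonneg_right (by linarith) hh0.le
    nlinarith
  have e2 : Λ * h ^ β = (X * h) ^ β := by
    rw [Real.mul_rpow hX hh0.le, ← Real.rpow_mul hΛ, one_div_mul_cancel hβ.ne', Real.rpow_one]
  have e3 : (X * h) ^ β * B ≤ 1 := by
    have e4 : B ≤ A ^ β := by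
      calc B = (B ^ (1 / β)) ^ β := by
            rw [← Real.rpow_mul hB0, one_div_mul_cancel hβ.ne', Real.rpow_one]
        _ ≤ A ^ β := Real.rpow_le_rpow hB1 (by linarith) hβ.le
    calc (X * h) ^ β * B ≤ (X * h) ^ β * A ^ β :=
          mul_le_mul_of_nonneg_left e4 (Real.rpow_nonneg hXh _)
      _ = (X * h * A) ^ β := (Real.mul_rpow hXh hA0.le).symm
      _ ≤ 1 := Real.rpow_le_one (by positivity) (by nlinarith) hβ.le
  have e5 : K * (Λ * h ^ β) * (1 + 2 * S) = (X * h) ^ β * B / 16 := by rw [e2, hB]; ring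
  linarith

theorem theorem5p7 (T H β p L : ℝ) [Fact (1 < p)] (hT : 0 < T) (hH : 1 / 2 < H) (hH1 : H < 1)
    (hβ : 1 / 2 < β) (hβH : β < H) (hp : p < 1 / (2 - 2 * H)) (hL : 0 < L) :
    ∃ τ₀ c₁ c₂ : ℝ, 0 < τ₀ ∧ 0 < c₁ ∧ 0 < c₂ ∧
      ∀ (b σ : ℝ → ℝ → PathSpace T → ℝ) (η : PathSpace T → ℝ),
        CoefficientHypothesis T p H L b σ →
        ∀ ω : PathSpace T, holderSeminorm β (coord ω) 0 T < ⊤ →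
          ∃ (Γ : ℝ → PathSpace T) (z : ℝ → ℝ),
            IsCharacteristicSolution p H β b σ η ω Γ z ∧
            (∀ (Γ' : ℝ → PathSpace T) (z' : ℝ → ℝ),
              IsCharacteristicSolution p H β b σ η ω Γ' z' →
              ∀ t ∈ Set.Icc 0 T, Γ' t = Γ t ∧ z' t = z t) ∧
            (∀ t ∈ Set.Icc 0 T, |z t| ≤ c₂ * (1 + |η ω|) *
              Real.exp (c₁ * (holderSeminorm β (coord ω) 0 T).toReal ^ (1 / β))) ∧
            (∀ a d : ℝ, 0 ≤ a → a < d → d ≤ T → d - a ≤ τ₀ →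
              holderSeminorm β z a d ≤ ENNReal.ofReal (c₂ * (1 + |η ω|) *
                Real.exp (c₁ * (holderSeminorm β (coord ω) 0 T).toReal ^ (1 / β)))) := by
  obtain ⟨C, hC0, hC⟩ := exists_phi_bound T p H hH1 hp
  have hβ0 : 0 < β := by linarith
  have hβ1 : β < 1 := hβH.trans hH1
  set K := 4 * (L + L * C + L * (L * C)) with hKdef
  have hK : 0 ≤ K := by positivity
  have hS := (sewConst_pos (θ := β + β) (by linarith)).le
  set S := sewConst (β + β)
  obtain ⟨A, hA⟩ : ∃ A, A = 16 * K + (16 * (K * (1 + 2 * S))) ^ (1 / β) + 1 := ⟨_, rfl⟩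
  have hA1 : 1 ≤ A := by
    have : 0 ≤ (16 * (K * (1 + 2 * S))) ^ (1 / β) := Real.rpow_nonneg (by positivity) _
    linarith
  have hA0 : 0 < A := by linarith
  refine ⟨1, T * A + 1, 8 * A * Real.exp (T * A), one_pos, by positivity, by positivity,
    fun b σ η hc ω hω => ?_⟩
  set Λ := (holderSeminorm β (coord ω) 0 T).toReal
  have hΛ : 0 ≤ Λ := ENNReal.toReal_nonneg
  have hsmall := scale_small hβ0 hK hS hΛ hA
  set X := Λ ^ (1 / β)
  have hX : 0 ≤ X := Real.rpow_nonneg hΛ _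
  set h := 1 / (A * (1 + X)) with hh
  have hh0 : 0 < h := by positivity
  have hh1 : h ≤ 1 := by
    rw [hh, div_le_one (by positivity)]
    nlinarith
  have hf := hc.youngVolterra hH hH1 hp hT.le hL.le hC0 hC ω
  have he : ‖((1, 0) : ℝ × HpSpace T p)‖ ≤ 1 := by simp [Prod.norm_def]
  have hy₀ : ‖((η ω, 0) : ℝ × HpSpace T p)‖ = |η ω| := by simp [Prod.norm_def]
  obtain ⟨y, hyB, hyP⟩ := hf.exists_solution hK hT.le hβ hβ1.le hΛ hh0 hh1 hsmall
    (abs_sub_le_of_holderSeminorm hω) (η ω, 0) he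
  rw [hy₀] at hyB
  have hsol := hc.isCharacteristicSolution hH1 hp hT.le hL.le hβ η ω hf
    (hyB.isHolder hβ0.le hT.le hh0) hyP
  -- the weighted bounds at the scale `h`, with `1 / h` replaced by its definition
  have hTh : T / h = T * A + T * A * X := by rw [hh]; field_simp
  have hexp : Real.exp (T / h) = Real.exp (T * A) * Real.exp (T * A * X) := by
    rw [hTh, Real.exp_add]
  have hexpX : Real.exp ((T * A + 1) * X) = Real.exp (T * A * X) * Real.exp X := by
    rw [← Real.exp_add]; congr 1; ring
  have hX1 : 1 + X ≤ Real.exp X := by linarith [Real.add_one_le_exp X]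
  have hη := abs_nonneg (η ω)
  have hbase : 0 ≤ (1 + |η ω|) * (Real.exp (T * A) * Real.exp (T * A * X)) := by positivity
  refine ⟨_, _, hsol, fun Γ' z' h' t ht =>
    hc.characteristicSolution_unique hH1 hp hT.le hL.le (fun s hs => (hC s hs).1) hβ hβ1 hK hω hf
      hsol h' t ht, fun t ht => ?_, fun a d ha _ hd _ => ?_⟩
  · have e1 := (norm_fst_le (y t)).trans (hyB.norm_le' hT.le hh0 t ht)
    rw [Real.norm_eq_abs, hexp] at e1
    rw [hexpX]
    -- the factor `A * exp X` is only needed for the Hölder bound, but the constants are shared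
    have e2 : 1 ≤ A * Real.exp X := one_le_mul_of_one_le_of_one_le hA1 (Real.one_le_exp hX)
    calc |(y t).1| ≤ (1 + 4 * |η ω|) * (Real.exp (T * A) * Real.exp (T * A * X)) := e1
      _ ≤ 8 * (1 + |η ω|) * (Real.exp (T * A) * Real.exp (T * A * X)) := by
        gcongr; linarith
      _ ≤ 8 * (1 + |η ω|) * (Real.exp (T * A) * Real.exp (T * A * X)) * (A * Real.exp X) :=
        le_mul_of_one_le_right (by positivity) e2
      _ = _ := by ring
  · refine holderSeminorm_le fun s t hs hst ht => ?_
    have e1 := (norm_fst_le (y t - y s)).trans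
      (hyB.holder_le hβ0.le hT.le hh0 s t (ha.trans hs) hst.le (ht.trans hd))
    refine e1.trans (mul_le_mul_of_nonneg_right ?_ (Real.rpow_nonneg (by linarith) _))
    -- the Hölder norm over times farther than `h` apart costs `1 / h ^ β ≤ 1 / h`
    have e2 : 1 / h ^ β ≤ A * Real.exp X := by
      have e3 : h ≤ h ^ β := by
        simpa using Real.rpow_le_rpow_of_exponent_ge hh0 hh1 hβ1.le
      calc 1 / h ^ β ≤ 1 / h := one_div_le_one_div_of_le hh0 e3
        _ = A * (1 + X) := by rw [hh, one_div_one_div]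
        _ ≤ _ := mul_le_mul_of_nonneg_left hX1 hA0.le
    rw [hexp, hexpX]
    calc 2 * ((1 + 4 * |η ω|) * (Real.exp (T * A) * Real.exp (T * A * X)) / h ^ β) =
          2 * ((1 + 4 * |η ω|) * (Real.exp (T * A) * Real.exp (T * A * X))) * (1 / h ^ β) := by ring
      _ ≤ 2 * (4 * (1 + |η ω|) * (Real.exp (T * A) * Real.exp (T * A * X))) *
          (A * Real.exp X) := by
        gcongr
        linarith
      _ = _ := by ring
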